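/- Theorem 1.1. Let $n\ge 2$ and $G=\mathbb{R}^n\setminus\{0\}$. For $x,y\in G$ let $$k_G(x,y)=\inf_{\gamma}\int_\gamma\frac{|dz|}{d(z,\partial G)},$$ where $d(z,\partial G)=|z|$ is the Euclidean distance from $z$ to $\partial G=\{0\}$ and the infimum is over all rectifiable curves $\gamma$ in $G$ joining $x$ and $y$, and let $D_G(x,M)=\{z\in G: k_G(x,z)<M\}$ be the quasihyperbolic ball. An open set $D$ is called strictly convex if for any two distinct points of $\overline{D}$ the open segment between them lies in $D$. A set $D$ is starlike with respect to $x\in D$ if for each $y\in D$ the line segment from $x$ to $y$ is contained in $D$. A domain $D$ is strictly starlike with respect to $x\in D$ if $D$ is bounded and each ray from $x$ meets $\partial D$ at exactly one point. The equation $$\cos\sqrt{p^2-1}+\sqrt{p^2-1}\,\sin\sqrt{p^2-1}=e^{-1}$$ has exactly one solution $p=\kappa$ in $[1,\pi]$, and $\kappa\approx 2.83297$ (correct to five decimals, $|\kappa-2.83297|\le 5\cdot 10^{-6}$). For every $n\ge2$ and every $x\in\mathbb{R}^n\setminus\{0\}$: 1) the quasihyperbolic ball $D_{\mathbb{R}^n\setminus\{0\}}(x,M)$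 is strictly convex for $M\in(0,1]$ and is not convex for $M>1$; 2) the quasihyperbolic ball $D_{\mathbb{R}^n\setminus\{0\}}(x,M)$ is a domain that is strictly starlike with respect to $x$ for $M\in(0,\kappa]$, and it is not starlike with respect to $x$ for $M>\kappa$. -/

import Mathlib

open scoped ENNReal

section Curves

variable {E : Type*} [NormedAddCommGroup E]

/-- The rectifiable curves `γ : [0,1] → G` that join `x` to `y`: continuous maps of bounded
variation (that is, of finite length) with values in `G`. Only the values of `γ` on `[0,1]`
matter. -/
def rectifiableCurves (G : Set E) (x y : E) : Set (ℝ → E) :=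
  {γ | ContinuousOn γ (Set.Icc 0 1) ∧ BoundedVariationOn γ (Set.Icc 0 1) ∧
    Set.MapsTo γ (Set.Icc 0 1) G ∧ γ 0 = x ∧ γ 1 = y}

/-- The length of the curve `γ : [0,1] → E`. -/
noncomputable def curveLength (γ : ℝ → E) : ℝ :=
  (eVariationOn γ (Set.Icc 0 1)).toReal

/-- The line integral `∫_γ ρ |dz|` of a nonnegative density along a rectifiable curve
`γ : [0,1] → E`: the integral over `[0, ℓ]`, where `ℓ` is the length of `γ`, of `ρ` along the
parametrization of `γ` by arc length. -/
noncomputable def lineIntegral (ρ : E → ℝ≥0∞) (γ : ℝ → E) : ℝ≥0∞ :=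
  ∫⁻ s in Set.Icc 0 (curveLength γ), ρ (naturalParameterization γ (Set.Icc 0 1) 0 s)

/-- The quasihyperbolic distance of `G`: the infimum of `∫_γ |dz| / d(z, ∂G)` over all
rectifiable curves `γ` in `G` that join `x` to `y`. -/
noncomputable def quasihyperbolicDist (G : Set E) (x y : E) : ℝ≥0∞ :=
  ⨅ γ ∈ rectifiableCurves G x y, lineIntegral (fun z => (Metric.infEDist z (frontier G))⁻¹) γ

/-- The quasihyperbolic ball `D_G(x, M)`. -/
def quasihyperbolicBall (G : Set E) (x : E) (M : ℝ) : Set E :=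
  {z | z ∈ G ∧ quasihyperbolicDist G x z < ENNReal.ofReal M}

variable [NormedSpace ℝ E]

/-- A set `G` is strictly convex if the open segment between any two distinct points of its
closure lies in its interior. (In particular `G` is convex, and for open `G` its boundary contains
no segment. Mathlib's `StrictConvex` looks at end points in `G` only, hence for an open set it
says no more than convexity.) -/
def IsStrictlyConvex (G : Set E) : Prop :=
  ∀ y ∈ closure G, ∀ z ∈ closure G, y ≠ z → openSegment ℝ y z ⊆ interior G

/-- `G` is a bounded domain containing `x`, and each ray from `x` meets the boundary of `G` in
exactly one point. -/
def IsStrictlyStarlike (x : E) (G : Set E) : Prop :=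
  IsOpen G ∧ IsConnected G ∧ x ∈ G ∧ Bornology.IsBounded G ∧
    ∀ v : E, v ≠ 0 → ∃! y : E, y ∈ frontier G ∧ ∃ t : ℝ, 0 ≤ t ∧ y = x + t • v

end Curves

/-- The equation that defines the constant `κ`. -/
def KappaEquation (p : ℝ) : Prop :=
  Real.cos (Real.sqrt (p ^ 2 - 1)) + Real.sqrt (p ^ 2 - 1) * Real.sin (Real.sqrt (p ^ 2 - 1))
    = Real.exp (-1)

/-!
In the closed half-plane through `z` bounded by the line `ℝ x`, let `w` be the complex coordinate
with `0 ↦ 0` and `x ↦ 1`, and put `ζ = log w`. Then `|dζ| ≤ |dz| / |z|`, with equality for curves in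
a fixed half-plane, so `|ζ|` is the quasihyperbolic distance from `x`, attained by logarithmic
spirals, and the ball is `{|ζ| < M}`.

*Convexity.* On a line `w = a + t c`, the second derivative of `|ζ| ^ 2` at a critical point has the
sign of `1 + Re ζ`. For `M ≤ 1` this is positive between any two points of the closed ball, which
excludes interior maxima. For `M > 1` it is negative near `ζ = -M`.

*Starlikeness.* On a ray `w = 1 + t c`, the derivative of `|ζ| ^ 2` has the sign of
`⟪ζ, 1 - exp (-ζ)⟫`, which for `ζ = u + i v` is the sign of `u exp u - u cos v + v sin v`. Here
`u exp u ≥ -exp (-1)`, with equality at `u = -1`. For `u ≤ 0` and `v ≥ π / 2`, the other two terms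
are smallest on the circle `|ζ| = r` at the point `-1 + i s` with `s = √(r ^ 2 - 1)`, where their
sum is `cos s + s sin s`. So the derivative first vanishes at `r = κ`.
-/

section Development

open Set Filter Topology MeasureTheory

open scoped NNReal

section ArcLength

variable {F : Type*} [MetricSpace F] {f : ℝ → F} {s : Set ℝ} {a b c : ℝ}

theorem continuousOn_variationOnFromTo (ha : a ∈ s) (hf : ContinuousOn f s)
    (hb : LocallyBoundedVariationOn f s) : ContinuousOn (variationOnFromTo f s a) s := by
  intro t ht
  have hleft := variationOnFromTo.tendsto_left ha ht hb ((hf t ht).mono inter_subset_left)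
  have hright := variationOnFromTo.tendsto_right ha ht hb ((hf t ht).mono inter_subset_left)
  rw [dist_self, sub_zero] at hleft
  rw [dist_self, add_zero] at hright
  have hunion : ContinuousWithinAt (variationOnFromTo f s a) (s ∩ Iio t ∪ s ∩ Ioi t) t :=
    continuousWithinAt_union.2 ⟨hleft, hright⟩
  rw [← inter_union_distrib_left, Iio_union_Ioi, ← sdiff_eq] at hunion
  exact continuousWithinAt_sdiff_self.1 hunion

theorem dist_le_variationOnFromTo_sub (ha : a ∈ s) (hb : b ∈ s) (hc : c ∈ s) (hbc : b ≤ c)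
    (hf : LocallyBoundedVariationOn f s) :
    dist (f b) (f c) ≤ variationOnFromTo f s a c - variationOnFromTo f s a b := by
  rw [variationOnFromTo.sub_right hf ha hc hb, variationOnFromTo.eq_of_le f s hbc, dist_edist]
  exact ENNReal.toReal_mono (hf b c hb hc)
    (eVariationOn.edist_le f ⟨hb, le_rfl, hbc⟩ ⟨hc, hbc, le_rfl⟩)

theorem naturalParameterization_variationOnFromTo (hf : LocallyBoundedVariationOn f s)
    (ha : a ∈ s) (hb : b ∈ s) :
    naturalParameterization f s a (variationOnFromTo f s a b) = f b :=
  edist_eq_zero.1 (edist_naturalParameterization_eq_zero hf ha hb)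

theorem lipschitzOnWith_naturalParameterization (hf : LocallyBoundedVariationOn f s) (ha : a ∈ s) :
    LipschitzOnWith 1 (naturalParameterization f s a) (variationOnFromTo f s a '' s) := by
  refine LipschitzOnWith.of_dist_le_mul ?_
  rintro _ ⟨t, ht, rfl⟩ _ ⟨t', ht', rfl⟩
  rw [naturalParameterization_variationOnFromTo hf ha ht,
    naturalParameterization_variationOnFromTo hf ha ht', NNReal.coe_one, one_mul, Real.dist_eq]
  rcases le_total t t' with h | h
  · rw [abs_sub_comm]
    exact (dist_le_variationOnFromTo_sub ha ht ht' h hf).trans (le_abs_self _)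
  · rw [dist_comm]
    exact (dist_le_variationOnFromTo_sub ha ht' ht h hf).trans (le_abs_self _)

theorem variationOnFromTo_sub_le_of_lipschitzOnWith {K : ℝ≥0}
    (hf : LocallyBoundedVariationOn f s) (ha : a ∈ s) (hb : b ∈ s) (hc : c ∈ s) (hbc : b ≤ c)
    (hK : LipschitzOnWith K f (Icc b c)) :
    variationOnFromTo f s a c - variationOnFromTo f s a b ≤ K * (c - b) := by
  rw [variationOnFromTo.sub_right hf ha hc hb, variationOnFromTo.eq_of_le f s hbc]
  refine ENNReal.toReal_le_of_le_ofReal (mul_nonneg K.2 (sub_nonneg.2 hbc)) ?_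
  calc eVariationOn f (s ∩ Icc b c) ≤ eVariationOn (f ∘ id) (Icc b c) :=
        eVariationOn.mono _ inter_subset_right
    _ ≤ K * eVariationOn (id : ℝ → ℝ) (Icc b c) := hK.comp_eVariationOn_le (mapsTo_id _)
    _ = ENNReal.ofReal (K * (c - b)) := by
        rw [eVariationOn_id_Icc, ENNReal.ofReal_mul K.coe_nonneg, ENNReal.ofReal_coe_nnreal]

end ArcLength

section SmoothArcLength

variable {E : Type*} [NormedAddCommGroup E] [NormedSpace ℝ E] {f f' : ℝ → E} {s : Set ℝ}
  {a b c t : ℝ}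

theorem abs_variationOnFromTo_sub_sub_le (hbv : LocallyBoundedVariationOn f s) (ha : a ∈ s)
    (hbc : b ≤ c) (hs : Icc b c ⊆ s) (hf : ∀ r ∈ Icc b c, HasDerivWithinAt f (f' r) s r) {v : E}
    {ε : ℝ} (hv : ∀ r ∈ Icc b c, ‖f' r - v‖ ≤ ε) :
    |variationOnFromTo f s a c - variationOnFromTo f s a b - ‖v‖ * (c - b)| ≤ ε * (c - b) := by
  have hb : b ∈ Icc b c := left_mem_Icc.2 hbc
  have hc : c ∈ Icc b c := right_mem_Icc.2 hbc
  have hε : 0 ≤ ε := (norm_nonneg _).trans (hv b hb)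
  have hupper : variationOnFromTo f s a c - variationOnFromTo f s a b
      ≤ (‖v‖ + ε).toNNReal * (c - b) := by
    refine variationOnFromTo_sub_le_of_lipschitzOnWith hbv ha (hs hb) (hs hc) hbc
      ((convex_Icc b c).lipschitzOnWith_of_nnnorm_hasDerivWithin_le
        (fun r hr => (hf r hr).mono hs) fun r hr => ?_)
    rw [← NNReal.coe_le_coe, coe_nnnorm, Real.coe_toNNReal _ (by positivity)]
    linarith [norm_le_norm_add_norm_sub' (f' r) v, hv r hr]
  have hlinear : ‖(f c - c • v) - (f b - b • v)‖ ≤ ε * ‖c - b‖ :=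
    (convex_Icc b c).norm_image_sub_le_of_norm_hasDerivWithin_le
      (f := fun r => f r - r • v) (f' := fun r => f' r - (1 : ℝ) • v)
      (fun r hr => ((hf r hr).mono hs).sub ((hasDerivWithinAt_id r _).smul_const v))
      (by simpa only [one_smul] using hv) hb hc
  rw [show f c - c • v - (f b - b • v) = f c - f b - (c - b) • v by module,
    Real.norm_of_nonneg (sub_nonneg.2 hbc)] at hlinear
  have hlower := dist_le_variationOnFromTo_sub ha (hs hb) (hs hc) hbc hbv
  have htriangle := norm_le_norm_add_norm_sub (f c - f b) ((c - b) • v)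
  rw [dist_comm, dist_eq_norm] at hlower
  rw [norm_smul, Real.norm_of_nonneg (sub_nonneg.2 hbc)] at htriangle
  rw [Real.coe_toNNReal _ (by positivity)] at hupper
  rw [abs_le]
  constructor <;> linarith

theorem hasDerivWithinAt_variationOnFromTo (hs : s.OrdConnected)
    (hbv : LocallyBoundedVariationOn f s) (hf : ∀ r ∈ s, HasDerivWithinAt f (f' r) s r)
    (hf' : ContinuousOn f' s) (ha : a ∈ s) (ht : t ∈ s) :
    HasDerivWithinAt (variationOnFromTo f s a) ‖f' t‖ s t := by
  refine hasDerivWithinAt_iff_isLittleO.2 (Asymptotics.isLittleO_iff.2 fun ε hε => ?_)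
  obtain ⟨δ, hδ, hball⟩ := Metric.continuousWithinAt_iff.1 (hf' t ht) ε hε
  have hbound : ∀ b ∈ s, ∀ c ∈ s, b ≤ c → (∀ r ∈ Icc b c, dist r t < δ) →
      |variationOnFromTo f s a c - variationOnFromTo f s a b - ‖f' t‖ * (c - b)|
        ≤ ε * (c - b) := fun b hb c hc hbc hr =>
    abs_variationOnFromTo_sub_sub_le hbv ha hbc (hs.out hb hc)
      (fun r h => hf r (hs.out hb hc h)) fun r h => by
        simpa only [dist_eq_norm] using (hball (hs.out hb hc h) (hr r h)).le
  filter_upwards [self_mem_nhdsWithin, nhdsWithin_le_nhds (Metric.ball_mem_nhds t hδ)]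
    with r hr hrt
  have hball : ∀ q ∈ uIcc t r, dist q t < δ := fun q hq => by
    rw [Real.dist_eq]
    exact (abs_sub_left_of_mem_uIcc hq).trans_lt (by rwa [← Real.dist_eq])
  rw [smul_eq_mul, Real.norm_eq_abs, Real.norm_eq_abs]
  rcases le_total t r with h | h
  · rw [abs_of_nonneg (sub_nonneg.2 h), mul_comm (r - t)]
    exact hbound t ht r hr h (by rwa [uIcc_of_le h] at hball)
  · rw [abs_sub_comm r, abs_of_nonneg (sub_nonneg.2 h), ← abs_neg]
    convert hbound r hr t ht h (by rwa [uIcc_of_ge h] at hball) using 2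
    ring

end SmoothArcLength

section LineIntegral

variable {E : Type*} [NormedAddCommGroup E] {U : Set E} {x y : E} {γ : ℝ → E}

theorem variationOnFromTo_one (γ : ℝ → E) :
    variationOnFromTo γ (Icc 0 1) 0 1 = curveLength γ := by
  rw [variationOnFromTo.eq_of_le _ _ zero_le_one, inter_self, curveLength]

theorem image_variationOnFromTo_Icc (hc : ContinuousOn γ (Icc 0 1))
    (hb : BoundedVariationOn γ (Icc 0 1)) :
    variationOnFromTo γ (Icc 0 1) 0 '' Icc 0 1 = Icc 0 (curveLength γ) := by
  have h0 : (0 : ℝ) ∈ Icc (0 : ℝ) 1 := left_mem_Icc.2 zero_le_one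
  rw [(continuousOn_variationOnFromTo h0 hc
    hb.locallyBoundedVariationOn).image_Icc_of_monotoneOn zero_le_one
      (variationOnFromTo.monotoneOn hb.locallyBoundedVariationOn h0),
    variationOnFromTo.self, variationOnFromTo_one]

theorem boundedVariationOn_Icc_of_hasDerivWithinAt [NormedSpace ℝ E] {γ' : ℝ → E} {a b : ℝ}
    (hγ : ∀ t ∈ Icc a b, HasDerivWithinAt γ (γ' t) (Icc a b) t)
    (hγ' : ContinuousOn γ' (Icc a b)) : BoundedVariationOn γ (Icc a b) := by
  obtain ⟨K, hK⟩ := isCompact_Icc.exists_bound_of_continuousOn hγ'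
  have hLip : LipschitzOnWith K.toNNReal γ (Icc a b) :=
    (convex_Icc a b).lipschitzOnWith_of_nnnorm_hasDerivWithin_le hγ fun t ht =>
      NNReal.coe_le_coe.1 ((hK t ht).trans (Real.le_coe_toNNReal K))
  exact hLip.comp_boundedVariationOn (mapsTo_id _) (BoundedVariationOn.id_Icc a b)

theorem lineIntegral_eq_lintegral_enorm_deriv_mul [NormedSpace ℝ E] {γ' : ℝ → E}
    (hγ : ∀ t ∈ Icc (0 : ℝ) 1, HasDerivWithinAt γ (γ' t) (Icc 0 1) t)
    (hγ' : ContinuousOn γ' (Icc 0 1)) (ρ : E → ℝ≥0∞) :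
    lineIntegral ρ γ = ∫⁻ t in Icc (0 : ℝ) 1, ‖γ' t‖ₑ * ρ (γ t) := by
  have h0 : (0 : ℝ) ∈ Icc (0 : ℝ) 1 := left_mem_Icc.2 zero_le_one
  have hb := boundedVariationOn_Icc_of_hasDerivWithinAt hγ hγ'
  have hbl := hb.locallyBoundedVariationOn
  have hderiv : ∀ t ∈ Icc (0 : ℝ) 1,
      HasDerivWithinAt (variationOnFromTo γ (Icc 0 1) 0) ‖γ' t‖ (Icc 0 1) t := fun t ht =>
    hasDerivWithinAt_variationOnFromTo ordConnected_Icc hbl hγ hγ' h0 ht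
  rw [lineIntegral,
    ← image_variationOnFromTo_Icc (fun t ht => (hγ t ht).continuousWithinAt) hb,
    lintegral_image_eq_lintegral_deriv_mul_of_monotoneOn measurableSet_Icc hderiv
      (variationOnFromTo.monotoneOn hbl h0)]
  refine setLIntegral_congr_fun measurableSet_Icc fun t ht => ?_
  rw [ofReal_norm, naturalParameterization_variationOnFromTo hbl h0 ht]

theorem exists_lipschitzWith_lineIntegral_eq (hγ : γ ∈ rectifiableCurves U x y) :
    ∃ c : ℝ → E, LipschitzWith 1 c ∧ (∀ s, c s ∈ U) ∧ c 0 = x ∧ c (curveLength γ) = y ∧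
      ∀ ρ : E → ℝ≥0∞, lineIntegral ρ γ = ∫⁻ s in Icc 0 (curveLength γ), ρ (c s) := by
  obtain ⟨hc, hb, hU, rfl, rfl⟩ := hγ
  have h0 : (0 : ℝ) ∈ Icc (0 : ℝ) 1 := left_mem_Icc.2 zero_le_one
  have h1 : (1 : ℝ) ∈ Icc (0 : ℝ) 1 := right_mem_Icc.2 zero_le_one
  have hbl := hb.locallyBoundedVariationOn
  have hℓ : 0 ≤ curveLength γ := ENNReal.toReal_nonneg
  have hnat : ∀ t ∈ Icc (0 : ℝ) 1, naturalParameterization γ (Icc 0 1) 0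
      (variationOnFromTo γ (Icc 0 1) 0 t) = γ t :=
    fun t ht => naturalParameterization_variationOnFromTo hbl h0 ht
  have himage := image_variationOnFromTo_Icc hc hb
  have hLip := lipschitzOnWith_naturalParameterization hbl h0
  rw [himage] at hLip
  refine ⟨fun s => naturalParameterization γ (Icc 0 1) 0 (projIcc 0 (curveLength γ) hℓ s),
    (mul_one (1 : ℝ≥0)) ▸ hLip.to_restrict.comp (LipschitzWith.projIcc hℓ),
    fun s => ?_, ?_, ?_, fun ρ => ?_⟩ <;> beta_reduce
  · obtain ⟨t, ht, hts⟩ := himage.symm.subset (projIcc 0 (curveLength γ) hℓ s).2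
    rw [← hts, hnat t ht]
    exact hU ht
  · rw [projIcc_left, ← hnat 0 h0, variationOnFromTo.self]
  · rw [projIcc_right, ← hnat 1 h1, variationOnFromTo_one]
  · refine setLIntegral_congr_fun measurableSet_Icc fun s hs => ?_
    simp only [projIcc_of_mem hℓ hs]

end LineIntegral

section UpperGradient

variable {E F : Type*} [NormedAddCommGroup E] [PseudoMetricSpace F] {U : Set E} {ρ : E → ℝ≥0}
  {f : E → F}

theorem eventually_dist_comp_le_of_lipschitzWith {c : ℝ → E} (hc : LipschitzWith 1 c)
    (hcU : ∀ s, c s ∈ U)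
    (hf : ∀ z ∈ U, ∀ r > ρ z, ∀ᶠ w in 𝓝[U] z, dist (f w) (f z) ≤ r * dist w z) (t : ℝ) {r : ℝ≥0}
    (hr : ρ (c t) < r) : ∀ᶠ s in 𝓝 t, dist (f (c s)) (f (c t)) ≤ r * dist s t := by
  have hct : Tendsto c (𝓝 t) (𝓝[U] (c t)) :=
    tendsto_nhdsWithin_iff.2 ⟨hc.continuous.continuousAt, Eventually.of_forall hcU⟩
  filter_upwards [hct.eventually (hf (c t) (hcU t) r hr)] with s hs
  refine hs.trans (mul_le_mul_of_nonneg_left ?_ r.2)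
  simpa only [NNReal.coe_one, one_mul] using hc.dist_le_mul s t

theorem dist_le_integral_of_lipschitzWith {c : ℝ → E} (hc : LipschitzWith 1 c) (hcU : ∀ s, c s ∈ U)
    (hρ : ContinuousOn ρ U)
    (hf : ∀ z ∈ U, ∀ r > ρ z, ∀ᶠ w in 𝓝[U] z, dist (f w) (f z) ≤ r * dist w z) {b : ℝ}
    (hb : 0 ≤ b) : dist (f (c b)) (f (c 0)) ≤ ∫ s in (0 : ℝ)..b, (ρ (c s) : ℝ) := by
  have hρc : Continuous fun s => (ρ (c s) : ℝ) :=
    NNReal.continuous_coe.comp (hρ.comp_continuous hc.continuous hcU)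
  have hlocal := eventually_dist_comp_le_of_lipschitzWith hc hcU hf
  have hfc : Continuous fun s => f (c s) := continuous_iff_continuousAt.2 fun t => by
    refine tendsto_iff_dist_tendsto_zero.2 (squeeze_zero' (Eventually.of_forall fun _ =>
      dist_nonneg) (hlocal t (lt_add_one _)) ?_)
    exact Continuous.tendsto' (by fun_prop) _ _ (by rw [dist_self, mul_zero])
  have hderiv : ∀ t, HasDerivAt (fun t => ∫ s in (0 : ℝ)..t, (ρ (c s) : ℝ)) (ρ (c t)) t :=
    fun t => hρc.integral_hasStrictDerivAt 0 t |>.hasDerivAt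
  refine image_le_of_liminf_slope_right_le_deriv_boundary (f := fun s => dist (f (c s)) (f (c 0)))
    (hfc.dist continuous_const).continuousOn (by rw [dist_self, intervalIntegral.integral_same])
    (fun t _ => (hderiv t).continuousAt.continuousWithinAt)
    (fun t _ => (hderiv t).hasDerivWithinAt) (fun t _ r hr => ?_) ⟨hb, le_rfl⟩
  obtain ⟨q, hq, hqr⟩ := exists_between hr
  lift q to ℝ≥0 using (NNReal.coe_nonneg _).trans hq.le
  refine Eventually.frequently ?_
  filter_upwards [nhdsWithin_le_nhds (hlocal t (NNReal.coe_lt_coe.1 hq)), self_mem_nhdsWithin]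
    with s hs hts
  have hts : 0 < s - t := sub_pos.2 hts
  rw [Real.dist_eq, abs_of_pos hts] at hs
  rw [slope_def_field, div_lt_iff₀ hts]
  calc dist (f (c s)) (f (c 0)) - dist (f (c t)) (f (c 0)) ≤ dist (f (c s)) (f (c t)) :=
        sub_le_iff_le_add.2 (dist_triangle _ _ _)
    _ ≤ q * (s - t) := hs
    _ < r * (s - t) := mul_lt_mul_of_pos_right hqr hts

theorem edist_le_lineIntegral (hρ : ContinuousOn ρ U)
    (hf : ∀ z ∈ U, ∀ r > ρ z, ∀ᶠ w in 𝓝[U] z, dist (f w) (f z) ≤ r * dist w z) {x y : E}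
    {γ : ℝ → E} (hγ : γ ∈ rectifiableCurves U x y) :
    edist (f y) (f x) ≤ lineIntegral (fun z => (ρ z : ℝ≥0∞)) γ := by
  obtain ⟨c, hc, hcU, rfl, rfl, hint⟩ := exists_lipschitzWith_lineIntegral_eq hγ
  have hℓ : 0 ≤ curveLength γ := ENNReal.toReal_nonneg
  have hρc : Continuous fun s => (ρ (c s) : ℝ) :=
    NNReal.continuous_coe.comp (hρ.comp_continuous hc.continuous hcU)
  have hle := dist_le_integral_of_lipschitzWith hc hcU hρ hf hℓ
  rw [intervalIntegral.integral_of_le hℓ, ← integral_Icc_eq_integral_Ioc] at hle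
  rw [hint, edist_dist]
  refine (ENNReal.ofReal_le_ofReal hle).trans (le_of_eq ?_)
  rw [ofReal_integral_eq_lintegral_ofReal hρc.integrableOn_Icc
    (Eventually.of_forall fun s => NNReal.coe_nonneg _)]
  simp only [ENNReal.ofReal_coe_nnreal]

end UpperGradient

section UpperHalfPlaneLog

open Complex

variable {z : ℂ}

theorem log_eq_log_neg_I_mul_add (hz : z ≠ 0) (hzi : 0 ≤ z.im) :
    log z = log (-I * z) + (Real.pi / 2 : ℝ) * I := by
  have harg : arg (-I) + arg z ∈ Ioc (-Real.pi) Real.pi := by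
    have h0 := arg_nonneg_iff.2 hzi
    have hpi := arg_le_pi z
    rw [arg_neg_I]
    constructor <;> linarith [Real.pi_pos]
  rw [log_mul (neg_ne_zero.2 I_ne_zero) hz harg, log_neg_I]
  push_cast
  ring

theorem neg_I_mul_mem_slitPlane (hz : z ≠ 0) (hzi : 0 ≤ z.im) : -I * z ∈ slitPlane := by
  rw [mem_slitPlane_iff]
  rcases hzi.eq_or_lt with h | h
  · exact Or.inr (by simpa using fun hre => hz (Complex.ext hre h.symm))
  · exact Or.inl (by simpa using h)

theorem exists_lipschitzOnWith_log (hz : z ≠ 0) (hzi : 0 ≤ z.im) {K : ℝ≥0} (hK : ‖z‖₊⁻¹ < K) :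
    ∃ s ∈ 𝓝[{w | 0 ≤ w.im}] z, LipschitzOnWith K log s := by
  have hderiv : HasStrictDerivAt (fun w => log (-I * w) + (Real.pi / 2 : ℝ) * I)
      (-I * 1 / (-I * z)) z :=
    (((hasStrictDerivAt_id z).const_mul (-I)).clog (neg_I_mul_mem_slitPlane hz hzi)).add_const _
  rw [mul_div_mul_left _ _ (neg_ne_zero.2 I_ne_zero), one_div] at hderiv
  obtain ⟨s, hs, hLip⟩ := hderiv.hasStrictFDerivAt.exists_lipschitzOnWith_of_nnnorm_lt K
    (by simpa using hK)
  refine ⟨s ∩ {0}ᶜ ∩ {w | 0 ≤ w.im}, inter_mem (mem_nhdsWithin_of_mem_nhds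
    (inter_mem hs (isOpen_compl_singleton.mem_nhds hz))) self_mem_nhdsWithin, ?_⟩
  refine LipschitzOnWith.of_dist_le_mul fun w hw v hv => ?_
  rw [log_eq_log_neg_I_mul_add hw.1.2 hw.2, log_eq_log_neg_I_mul_add hv.1.2 hv.2]
  exact hLip.dist_le_mul w hw.1.1 v hv.1.1

theorem continuousWithinAt_log_im_nonneg (hz : z ≠ 0) (hzi : 0 ≤ z.im) :
    ContinuousWithinAt log {w | 0 ≤ w.im} z := by
  obtain ⟨s, hs, hLip⟩ := exists_lipschitzOnWith_log hz hzi (lt_add_one _)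
  exact (hLip.continuousOn z (mem_of_mem_nhdsWithin hzi hs)).mono_of_mem_nhdsWithin hs

end UpperHalfPlaneLog

section HalfPlaneCoordinates

variable {E : Type*} [NormedAddCommGroup E] [InnerProductSpace ℝ E] {x e : E}

/-- The coordinates of `z` in a half-plane that contains `z` and is bounded by the line through
`0` and `x`, as a complex number with nonnegative imaginary part and scaled so that `x` has the
coordinate `1`. -/
noncomputable def halfPlaneCoord (x z : E) : ℂ :=
  ⟨inner ℝ x z / ‖x‖ ^ 2, ‖(ℝ ∙ x)ᗮ.starProjection z‖ / ‖x‖⟩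

theorem halfPlaneCoord_im_nonneg (x z : E) : 0 ≤ (halfPlaneCoord x z).im :=
  div_nonneg (norm_nonneg _) (norm_nonneg _)

theorem halfPlaneCoord_re_add (x z w : E) :
    (halfPlaneCoord x (z + w)).re = (halfPlaneCoord x z).re + (halfPlaneCoord x w).re := by
  simp only [halfPlaneCoord, inner_add_right, add_div]

theorem halfPlaneCoord_re_smul (x z : E) (t : ℝ) :
    (halfPlaneCoord x (t • z)).re = t * (halfPlaneCoord x z).re := by
  simp only [halfPlaneCoord, inner_smul_right, mul_div_assoc]

theorem halfPlaneCoord_im_add_le (x z w : E) :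
    (halfPlaneCoord x (z + w)).im ≤ (halfPlaneCoord x z).im + (halfPlaneCoord x w).im := by
  simp only [halfPlaneCoord, map_add, ← add_div]
  exact div_le_div_of_nonneg_right (norm_add_le _ _) (norm_nonneg _)

theorem halfPlaneCoord_im_smul (x z : E) (t : ℝ) :
    (halfPlaneCoord x (t • z)).im = |t| * (halfPlaneCoord x z).im := by
  simp only [halfPlaneCoord, map_smul, norm_smul, Real.norm_eq_abs, mul_div_assoc]

theorem halfPlaneCoord_combo_re (x y z : E) (s t : ℝ) : (halfPlaneCoord x (s • y + t • z)).re =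
    (s • halfPlaneCoord x y + t • halfPlaneCoord x z).re := by
  simp only [halfPlaneCoord_re_add, halfPlaneCoord_re_smul, Complex.add_re, Complex.smul_re,
    smul_eq_mul]

theorem halfPlaneCoord_combo_im_le (x y z : E) {s t : ℝ} (hs : 0 ≤ s) (ht : 0 ≤ t) :
    (halfPlaneCoord x (s • y + t • z)).im ≤
      (s • halfPlaneCoord x y + t • halfPlaneCoord x z).im := by
  simpa only [halfPlaneCoord_im_smul, abs_of_nonneg hs, abs_of_nonneg ht, Complex.add_im,
    Complex.smul_im, smul_eq_mul] using halfPlaneCoord_im_add_le x (s • y) (t • z)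

theorem starProjection_orthogonal_singleton_self (x : E) : (ℝ ∙ x)ᗮ.starProjection x = 0 := by
  rw [Submodule.starProjection_orthogonal_val,
    Submodule.starProjection_eq_self_iff.2 (Submodule.mem_span_singleton_self x), sub_self]

theorem halfPlaneCoord_zero (x : E) : halfPlaneCoord x 0 = 0 := by
  simpa [Complex.ext_iff] using And.intro (halfPlaneCoord_re_smul x 0 0)
    (halfPlaneCoord_im_smul x 0 0)

theorem halfPlaneCoord_self (hx : x ≠ 0) : halfPlaneCoord x x = 1 := by
  rw [halfPlaneCoord, real_inner_self_eq_norm_sq, div_self (by simpa using hx),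
    starProjection_orthogonal_singleton_self, norm_zero, zero_div]
  rfl

theorem halfPlaneCoord_add_smul (hx : x ≠ 0) (v : E) {t : ℝ} (ht : 0 ≤ t) :
    halfPlaneCoord x (x + t • v) = 1 + t * halfPlaneCoord x v := by
  apply Complex.ext
  · simp only [halfPlaneCoord_re_add, halfPlaneCoord_re_smul, halfPlaneCoord_self hx,
      Complex.add_re, Complex.re_ofReal_mul]
  · rw [Complex.add_im, Complex.one_im, zero_add, Complex.im_ofReal_mul]
    simp only [halfPlaneCoord, map_add, map_smul, starProjection_orthogonal_singleton_self,
      zero_add, norm_smul, Real.norm_of_nonneg ht, mul_div_assoc]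

theorem eq_halfPlaneCoord_re_smul_add (x z : E) :
    z = (halfPlaneCoord x z).re • x + (ℝ ∙ x)ᗮ.starProjection z := by
  rw [Submodule.starProjection_orthogonal_val, Submodule.starProjection_singleton]
  exact (add_sub_cancel _ _).symm

theorem norm_halfPlaneCoord (hx : x ≠ 0) (z : E) : ‖halfPlaneCoord x z‖ = ‖z‖ / ‖x‖ := by
  have hx0 : ‖x‖ ≠ 0 := norm_ne_zero_iff.2 hx
  have hpyth := (ℝ ∙ x).norm_sq_eq_add_norm_sq_starProjection z
  rw [Submodule.starProjection_singleton, norm_smul, Real.norm_eq_abs, mul_pow, sq_abs] at hpyth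
  rw [← sq_eq_sq₀ (norm_nonneg _) (by positivity), Complex.sq_norm, Complex.normSq_apply, div_pow,
    hpyth]
  simp only [halfPlaneCoord, RCLike.ofReal_real_eq_id, id]
  field_simp

theorem norm_halfPlaneCoord_inj (hx : x ≠ 0) {z w : E} :
    ‖halfPlaneCoord x z‖ = ‖halfPlaneCoord x w‖ ↔ ‖z‖ = ‖w‖ := by
  rw [norm_halfPlaneCoord hx, norm_halfPlaneCoord hx, div_left_inj' (norm_ne_zero_iff.2 hx)]

theorem halfPlaneCoord_ne_zero (hx : x ≠ 0) {z : E} (hz : z ≠ 0) : halfPlaneCoord x z ≠ 0 := by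
  rw [← norm_ne_zero_iff, norm_halfPlaneCoord hx]
  exact div_ne_zero (norm_ne_zero_iff.2 hz) (norm_ne_zero_iff.2 hx)

theorem norm_halfPlaneCoord_sub_le (hx : x ≠ 0) (z w : E) :
    ‖halfPlaneCoord x z - halfPlaneCoord x w‖ ≤ ‖x‖⁻¹ * ‖z - w‖ := by
  have hre : (halfPlaneCoord x z - halfPlaneCoord x w).re = (halfPlaneCoord x (z - w)).re := by
    simp only [halfPlaneCoord, Complex.sub_re, inner_sub_right, sub_div]
  have him : |(halfPlaneCoord x z - halfPlaneCoord x w).im| ≤ |(halfPlaneCoord x (z - w)).im| := by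
    simp only [halfPlaneCoord, Complex.sub_im, map_sub, ← sub_div, abs_div, abs_norm]
    exact div_le_div_of_nonneg_right (abs_norm_sub_norm_le _ _) (norm_nonneg _)
  rw [inv_mul_eq_div, ← norm_halfPlaneCoord hx (z - w),
    ← sq_le_sq₀ (norm_nonneg _) (norm_nonneg _), Complex.sq_norm, Complex.sq_norm,
    Complex.normSq_apply, Complex.normSq_apply, hre, ← sq, ← sq, ← sq]
  exact add_le_add_right (sq_le_sq.2 him) _

theorem lipschitzWith_halfPlaneCoord (hx : x ≠ 0) : LipschitzWith ‖x‖₊⁻¹ (halfPlaneCoord x) :=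
  LipschitzWith.of_dist_le_mul fun z w => by
    simpa only [dist_eq_norm, NNReal.coe_inv, coe_nnnorm] using norm_halfPlaneCoord_sub_le hx z w

/-- The real linear map `ℂ → E` that sends `1` to `x` and `I` to `e`. When `e` is orthogonal to `x`
and of the same norm, it is a similarity onto a plane, and `halfPlaneCoord x` inverts it on the
upper half-plane. -/
noncomputable def planeEmbedding (x e : E) : ℂ →L[ℝ] E :=
  Complex.reCLM.smulRight x + Complex.imCLM.smulRight e

theorem planeEmbedding_apply (x e : E) (c : ℂ) : planeEmbedding x e c = c.re • x + c.im • e :=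
  rfl

theorem norm_planeEmbedding (he : inner ℝ x e = 0) (hn : ‖e‖ = ‖x‖) (c : ℂ) :
    ‖planeEmbedding x e c‖ = ‖x‖ * ‖c‖ := by
  have hortho : inner ℝ (c.re • x) (c.im • e) = 0 := by
    rw [inner_smul_left, inner_smul_right, he, mul_zero, mul_zero]
  rw [← sq_eq_sq₀ (norm_nonneg _) (by positivity), planeEmbedding_apply, sq,
    norm_add_sq_eq_norm_sq_add_norm_sq_real hortho, norm_smul, norm_smul, hn, mul_pow,
    Complex.sq_norm, Complex.normSq_apply, Real.norm_eq_abs, Real.norm_eq_abs,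
    ← abs_mul_abs_self c.re, ← abs_mul_abs_self c.im]
  ring

theorem planeEmbedding_exp_ne_zero (hx : x ≠ 0) (he : inner ℝ x e = 0) (hn : ‖e‖ = ‖x‖)
    (ζ : ℂ) : planeEmbedding x e (Complex.exp ζ) ≠ 0 := by
  rw [← norm_ne_zero_iff, norm_planeEmbedding he hn]
  exact mul_ne_zero (norm_ne_zero_iff.2 hx) (norm_ne_zero_iff.2 (Complex.exp_ne_zero _))

theorem halfPlaneCoord_planeEmbedding (hx : x ≠ 0) (he : inner ℝ x e = 0) (hn : ‖e‖ = ‖x‖) {c : ℂ}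
    (hc : 0 ≤ c.im) : halfPlaneCoord x (planeEmbedding x e c) = c := by
  have hx0 : ‖x‖ ≠ 0 := norm_ne_zero_iff.2 hx
  have he' : (ℝ ∙ x)ᗮ.starProjection e = e :=
    Submodule.starProjection_eq_self_iff.2 (Submodule.mem_orthogonal_singleton_iff_inner_right.2 he)
  apply Complex.ext
  · simp only [halfPlaneCoord, planeEmbedding_apply, inner_add_right, inner_smul_right, he,
      real_inner_self_eq_norm_sq]
    field_simp
    ring
  · simp only [halfPlaneCoord, planeEmbedding_apply, map_add, map_smul,
      starProjection_orthogonal_singleton_self, smul_zero, zero_add, he', norm_smul, hn,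
      Real.norm_of_nonneg hc, mul_div_cancel_right₀ _ hx0]

theorem exists_orthogonal_ne_zero (hE : 1 < Module.rank ℝ E) (x : E) :
    ∃ e ∈ (ℝ ∙ x)ᗮ, e ≠ 0 := by
  refine Submodule.exists_mem_ne_zero_of_ne_bot fun hbot => hE.not_ge ?_
  rw [Submodule.orthogonal_eq_bot_iff] at hbot
  rw [← rank_top, ← hbot]
  exact (rank_span_le _).trans (Cardinal.mk_singleton x).le

theorem exists_planeEmbedding_halfPlaneCoord_eq (hE : 1 < Module.rank ℝ E) (hx : x ≠ 0) (z : E) :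
    ∃ e : E, inner ℝ x e = 0 ∧ ‖e‖ = ‖x‖ ∧ planeEmbedding x e (halfPlaneCoord x z) = z := by
  obtain ⟨u, hu, hu0, hzu⟩ : ∃ u ∈ (ℝ ∙ x)ᗮ, u ≠ 0 ∧
      (‖(ℝ ∙ x)ᗮ.starProjection z‖ / ‖u‖) • u = (ℝ ∙ x)ᗮ.starProjection z := by
    by_cases hw : (ℝ ∙ x)ᗮ.starProjection z = 0
    · obtain ⟨u, hu, hu0⟩ := exists_orthogonal_ne_zero hE x
      exact ⟨u, hu, hu0, by rw [hw, norm_zero, zero_div, zero_smul]⟩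
    · exact ⟨_, Submodule.starProjection_apply_mem _ z, hw, by
        rw [div_self (norm_ne_zero_iff.2 hw), one_smul]⟩
  have hun : ‖u‖ ≠ 0 := norm_ne_zero_iff.2 hu0
  refine ⟨(‖x‖ / ‖u‖) • u, ?_, ?_, ?_⟩
  · rw [inner_smul_right, Submodule.mem_orthogonal_singleton_iff_inner_right.1 hu, mul_zero]
  · rw [norm_smul, norm_div, norm_norm, norm_norm, div_mul_cancel₀ _ hun]
  · conv_rhs => rw [eq_halfPlaneCoord_re_smul_add x z, ← hzu]
    rw [planeEmbedding_apply, smul_smul]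
    congr 2
    exact div_mul_div_cancel₀ (norm_ne_zero_iff.2 hx)

end HalfPlaneCoordinates

section QuasihyperbolicDistance

variable {E : Type*} [NormedAddCommGroup E] [InnerProductSpace ℝ E] {x y z : E} {M : ℝ}

/-- The logarithm of `halfPlaneCoord x z`. In this coordinate the density `‖z‖⁻¹` of the
quasihyperbolic metric of the punctured space becomes the Euclidean one. -/
noncomputable def logCoord (x z : E) : ℂ :=
  Complex.log (halfPlaneCoord x z)

theorem logCoord_self (hx : x ≠ 0) : logCoord x x = 0 := by
  rw [logCoord, halfPlaneCoord_self hx, Complex.log_one]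

theorem exp_logCoord (hx : x ≠ 0) (hz : z ≠ 0) :
    Complex.exp (logCoord x z) = halfPlaneCoord x z :=
  Complex.exp_log (halfPlaneCoord_ne_zero hx hz)

theorem norm_eq_norm_mul_exp_logCoord_re (hx : x ≠ 0) (hz : z ≠ 0) :
    ‖z‖ = ‖x‖ * Real.exp (logCoord x z).re := by
  rw [← Complex.norm_exp, exp_logCoord hx hz, norm_halfPlaneCoord hx,
    mul_div_cancel₀ _ (norm_ne_zero_iff.2 hx)]

theorem logCoord_planeEmbedding_exp {e : E} (hx : x ≠ 0) (he : inner ℝ x e = 0) (hn : ‖e‖ = ‖x‖)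
    {ζ : ℂ} (h0 : 0 ≤ ζ.im) (hπ : ζ.im ≤ Real.pi) :
    logCoord x (planeEmbedding x e (Complex.exp ζ)) = ζ := by
  have him : 0 ≤ (Complex.exp ζ).im := by
    rw [Complex.exp_im]
    exact mul_nonneg (Real.exp_pos _).le (Real.sin_nonneg_of_nonneg_of_le_pi h0 hπ)
  rw [logCoord, halfPlaneCoord_planeEmbedding hx he hn him,
    Complex.log_exp (by linarith [Real.pi_pos]) hπ]

theorem continuousAt_logCoord (hx : x ≠ 0) (hz : z ≠ 0) : ContinuousAt (logCoord x) z :=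
  (continuousWithinAt_log_im_nonneg (halfPlaneCoord_ne_zero hx hz)
    (halfPlaneCoord_im_nonneg x z)).tendsto.comp
    (tendsto_nhdsWithin_iff.2 ⟨(lipschitzWith_halfPlaneCoord hx).continuous.continuousAt,
      Eventually.of_forall (halfPlaneCoord_im_nonneg x)⟩)

theorem eventually_dist_logCoord_le (hx : x ≠ 0) (hz : z ≠ 0) {r : ℝ≥0} (hr : ‖z‖₊⁻¹ < r) :
    ∀ᶠ w in 𝓝 z, dist (logCoord x w) (logCoord x z) ≤ r * dist w z := by
  have hx0 : 0 < ‖x‖₊ := by simpa using hx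
  have hnorm : ‖halfPlaneCoord x z‖₊⁻¹ < r * ‖x‖₊ := by
    have hcoord : ‖halfPlaneCoord x z‖₊ = ‖z‖₊ / ‖x‖₊ := NNReal.eq (norm_halfPlaneCoord hx z)
    rw [hcoord, inv_div, div_eq_inv_mul]
    exact mul_lt_mul_of_pos_right hr hx0
  obtain ⟨s, hs, hLip⟩ := exists_lipschitzOnWith_log (halfPlaneCoord_ne_zero hx hz)
    (halfPlaneCoord_im_nonneg x z) hnorm
  have hcoord : Tendsto (halfPlaneCoord x) (𝓝 z) (𝓝[{w | 0 ≤ w.im}] (halfPlaneCoord x z)) :=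
    tendsto_nhdsWithin_iff.2 ⟨(lipschitzWith_halfPlaneCoord hx).continuous.continuousAt,
      Eventually.of_forall (halfPlaneCoord_im_nonneg x)⟩
  filter_upwards [hcoord hs] with w hw
  have hzs := mem_of_mem_nhdsWithin (s := {w : ℂ | 0 ≤ w.im}) (halfPlaneCoord_im_nonneg x z) hs
  calc dist (logCoord x w) (logCoord x z)
      ≤ (r * ‖x‖₊ : ℝ≥0) * dist (halfPlaneCoord x w) (halfPlaneCoord x z) :=
        hLip.dist_le_mul _ hw _ hzs
    _ ≤ (r * ‖x‖₊ : ℝ≥0) * ((‖x‖₊⁻¹ : ℝ≥0) * dist w z) := by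
        gcongr
        exact (lipschitzWith_halfPlaneCoord hx).dist_le_mul w z
    _ = r * dist w z := by
        rw [← mul_assoc, ← NNReal.coe_mul, mul_inv_cancel_right₀ hx0.ne']

theorem infEDist_frontier_compl_zero [Nontrivial E] (z : E) :
    Metric.infEDist z (frontier ({0}ᶜ : Set E)) = ‖z‖ₑ := by
  have : (𝓝[≠] (0 : E)).NeBot := Module.punctured_nhds_neBot ℝ E 0
  rw [frontier_compl, frontier, closure_singleton, interior_singleton, sdiff_empty,
    Metric.infEDist_singleton, edist_zero_right]

theorem enorm_logCoord_le_lineIntegral (hx : x ≠ 0) {γ : ℝ → E}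
    (hγ : γ ∈ rectifiableCurves {0}ᶜ x y) :
    ‖logCoord x y‖ₑ ≤ lineIntegral (fun z => ‖z‖ₑ⁻¹) γ := by
  have hcont : ContinuousOn (fun z : E => ‖z‖₊⁻¹) {0}ᶜ := fun z hz =>
    (continuous_nnnorm.continuousAt.inv₀ (nnnorm_ne_zero_iff.2 hz)).continuousWithinAt
  calc ‖logCoord x y‖ₑ = edist (logCoord x y) (logCoord x x) := by
        rw [logCoord_self hx, edist_zero_right]
    _ ≤ lineIntegral (fun z => ((‖z‖₊⁻¹ : ℝ≥0) : ℝ≥0∞)) γ :=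
        edist_le_lineIntegral hcont (fun z hz r hr =>
          mem_nhdsWithin_of_mem_nhds (eventually_dist_logCoord_le hx hz hr)) hγ
    _ ≤ lineIntegral (fun z => ‖z‖ₑ⁻¹) γ := lintegral_mono fun _ => ENNReal.coe_inv_le

/-- The curve that `logCoord x` maps to the segment from `0` to `ζ`: a logarithmic spiral in the
plane spanned by `x` and `e`. -/
noncomputable def spiral (x e : E) (ζ : ℂ) (t : ℝ) : E :=
  planeEmbedding x e (Complex.exp (t * ζ))

theorem hasDerivAt_spiral (x e : E) (ζ : ℂ) (t : ℝ) :
    HasDerivAt (spiral x e ζ) (planeEmbedding x e (Complex.exp (t * ζ) * ζ)) t := by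
  have hexp : HasDerivAt (fun t : ℝ => Complex.exp (t * ζ)) (Complex.exp (t * ζ) * ζ) t := by
    simpa using ((hasDerivAt_id (t : ℂ)).mul_const ζ).cexp.comp_ofReal
  exact (planeEmbedding x e).hasFDerivAt.comp_hasDerivAt t hexp

theorem spiral_mem_rectifiableCurves {e : E} (hx : x ≠ 0) (he : inner ℝ x e = 0) (hn : ‖e‖ = ‖x‖)
    (ζ : ℂ) :
    spiral x e ζ ∈ rectifiableCurves {0}ᶜ x (planeEmbedding x e (Complex.exp ζ)) := by
  refine ⟨fun t _ => (hasDerivAt_spiral x e ζ t).continuousAt.continuousWithinAt,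
    boundedVariationOn_Icc_of_hasDerivWithinAt
      (fun t _ => (hasDerivAt_spiral x e ζ t).hasDerivWithinAt) (by fun_prop),
    fun t _ => planeEmbedding_exp_ne_zero hx he hn _, ?_, ?_⟩
  · simp [spiral, planeEmbedding_apply]
  · simp [spiral]

theorem lineIntegral_spiral {e : E} (hx : x ≠ 0) (he : inner ℝ x e = 0) (hn : ‖e‖ = ‖x‖) (ζ : ℂ) :
    lineIntegral (fun z => ‖z‖ₑ⁻¹) (spiral x e ζ) = ‖ζ‖ₑ := by
  have hspeed : ∀ t : ℝ, ‖planeEmbedding x e (Complex.exp (t * ζ) * ζ)‖ₑ * ‖spiral x e ζ t‖ₑ⁻¹ =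
      ‖ζ‖ₑ := fun t => by
    have hpos : 0 < ‖x‖ * ‖Complex.exp (t * ζ)‖ :=
      mul_pos (norm_pos_iff.2 hx) (norm_pos_iff.2 (Complex.exp_ne_zero _))
    rw [← ofReal_norm, ← ofReal_norm, ← ofReal_norm, spiral, norm_planeEmbedding he hn,
      norm_planeEmbedding he hn, ← div_eq_mul_inv, ← ENNReal.ofReal_div_of_pos hpos,
      norm_mul, ← mul_assoc, mul_div_cancel_left₀ _ hpos.ne']
  rw [lineIntegral_eq_lintegral_enorm_deriv_mul
    (fun t _ => (hasDerivAt_spiral x e ζ t).hasDerivWithinAt) (by fun_prop)]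
  simp only [hspeed, lintegral_const, Measure.restrict_apply_univ, Real.volume_Icc, sub_zero,
    ENNReal.ofReal_one, mul_one]

theorem quasihyperbolicDist_compl_zero (hE : 1 < Module.rank ℝ E) (hx : x ≠ 0) (hy : y ≠ 0) :
    quasihyperbolicDist {0}ᶜ x y = ‖logCoord x y‖ₑ := by
  have : Nontrivial E := ⟨x, 0, hx⟩
  simp only [quasihyperbolicDist, infEDist_frontier_compl_zero]
  refine le_antisymm ?_ (le_iInf₂ fun γ hγ => enorm_logCoord_le_lineIntegral hx hγ)
  obtain ⟨e, he, hn, hye⟩ := exists_planeEmbedding_halfPlaneCoord_eq hE hx y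
  refine (iInf₂_le (spiral x e (logCoord x y)) ?_).trans (lineIntegral_spiral hx he hn _).le
  convert spiral_mem_rectifiableCurves hx he hn (logCoord x y)
  rw [exp_logCoord hx hy, hye]

/-- The quasihyperbolic ball of the punctured space, described by the coordinate `logCoord`. -/
def logBall (x : E) (M : ℝ) : Set E :=
  {z | z ≠ 0 ∧ ‖logCoord x z‖ < M}

theorem quasihyperbolicBall_compl_zero (hE : 1 < Module.rank ℝ E) (hx : x ≠ 0) (M : ℝ) :
    quasihyperbolicBall {0}ᶜ x M = logBall x M := by
  ext z
  refine and_congr_right fun hz => ?_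
  rw [quasihyperbolicDist_compl_zero hE hx hz, ← ofReal_norm,
    ENNReal.ofReal_lt_ofReal_iff_of_nonneg (norm_nonneg _)]

end QuasihyperbolicDistance

section LogBall

variable {E : Type*} [NormedAddCommGroup E] [InnerProductSpace ℝ E] {x z : E} {M : ℝ}

theorem self_mem_logBall (hx : x ≠ 0) (hM : 0 < M) : x ∈ logBall x M :=
  ⟨hx, by rwa [logCoord_self hx, norm_zero]⟩

theorem isOpen_logBall (hx : x ≠ 0) (M : ℝ) : IsOpen (logBall x M) := by
  refine isOpen_iff_mem_nhds.2 fun z hz => ?_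
  filter_upwards [isOpen_ne.mem_nhds hz.1,
    (continuousAt_logCoord hx hz.1).norm.eventually (gt_mem_nhds hz.2)] with w h0 hM
  exact ⟨h0, hM⟩

theorem norm_le_of_mem_logBall (hx : x ≠ 0) (hz : z ∈ logBall x M) : ‖z‖ ≤ ‖x‖ * Real.exp M := by
  rw [norm_eq_norm_mul_exp_logCoord_re hx hz.1]
  gcongr
  exact (Complex.re_le_norm _).trans hz.2.le

theorem le_norm_of_mem_logBall (hx : x ≠ 0) (hz : z ∈ logBall x M) :
    ‖x‖ * Real.exp (-M) ≤ ‖z‖ := by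
  rw [norm_eq_norm_mul_exp_logCoord_re hx hz.1]
  gcongr
  exact (neg_le_neg hz.2.le).trans (neg_le_of_abs_le (Complex.abs_re_le_norm _))

theorem isBounded_logBall (hx : x ≠ 0) (M : ℝ) : Bornology.IsBounded (logBall x M) :=
  isBounded_iff_forall_norm_le.2 ⟨_, fun _ hz => norm_le_of_mem_logBall hx hz⟩

theorem closure_logBall_subset (hx : x ≠ 0) :
    closure (logBall x M) ⊆ {z | z ≠ 0 ∧ ‖logCoord x z‖ ≤ M} := by
  intro z hz
  have hle : ‖x‖ * Real.exp (-M) ≤ ‖z‖ :=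
    closure_minimal (fun w hw => le_norm_of_mem_logBall hx hw)
      (isClosed_le continuous_const continuous_norm) hz
  have hz0 : z ≠ 0 := norm_pos_iff.1 (lt_of_lt_of_le (by positivity) hle)
  obtain ⟨u, hu, hlim⟩ := mem_closure_iff_seq_limit.1 hz
  exact ⟨hz0, le_of_tendsto' ((continuousAt_logCoord hx hz0).norm.tendsto.comp hlim)
    fun n => (hu n).2.le⟩

end LogBall

section StrictQuasiconvexity

open Complex ComplexConjugate

theorem hasDerivAt_norm_log_sq {n : ℝ → ℂ} {n' : ℂ} {t : ℝ} (hn : HasDerivAt n n' t)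
    (hslit : n t ∈ slitPlane) :
    HasDerivAt (fun s => ‖log (n s)‖ ^ 2) (2 * inner ℝ (log (n t)) (n' / n t)) t :=
  (hn.clog_real hslit).norm_sq

theorem hasDerivAt_line (a c : ℂ) (t : ℝ) : HasDerivAt (fun s : ℝ => a + s * c) c t := by
  simpa using (((hasDerivAt_id (t : ℂ)).mul_const c).const_add a).comp_ofReal

theorem deriv_deriv_norm_log_sq_line {a c : ℂ} {t : ℝ} (hslit : a + t * c ∈ slitPlane) :
    deriv (deriv fun s : ℝ => ‖log (a + s * c)‖ ^ 2) t =
      2 * (‖c / (a + t * c)‖ ^ 2 - inner ℝ (log (a + t * c)) ((c / (a + t * c)) ^ 2)) := by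
  have hcont : Continuous fun s : ℝ => a + s * c := by fun_prop
  have hderiv : deriv (fun s : ℝ => ‖log (a + s * c)‖ ^ 2) =ᶠ[𝓝 t]
      fun s => 2 * inner ℝ (log (a + s * c)) (c / (a + s * c)) := by
    filter_upwards [hcont.continuousAt.eventually_mem (isOpen_slitPlane.mem_nhds hslit)] with s hs
    exact (hasDerivAt_norm_log_sq (hasDerivAt_line a c s) hs).deriv
  have hquot : HasDerivAt (fun s : ℝ => c / (a + s * c)) (-(c / (a + t * c)) ^ 2) t := by
    convert! (hasDerivAt_const t c).div (hasDerivAt_line a c t) (slitPlane_ne_zero hslit) using 1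
    rw [zero_mul, zero_sub, div_pow, neg_div, sq c]
  rw [hderiv.deriv_eq,
    ((((hasDerivAt_line a c t).clog_real hslit).inner ℝ hquot).const_mul 2).deriv,
    real_inner_self_eq_norm_sq, inner_neg_right]
  ring

theorem neg_inner_sq_eq_of_inner_eq_zero {ζ v : ℂ} (h : inner ℝ ζ v = 0) :
    -inner ℝ ζ (v ^ 2) = ‖v‖ ^ 2 * ζ.re := by
  rw [Complex.inner] at h ⊢
  rw [Complex.sq_norm, normSq_apply]
  simp only [sq, mul_re, mul_im, conj_re, conj_im] at h ⊢
  linear_combination (-2 * v.re) * h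

theorem not_isLocalMax_norm_log_sq_line {a c : ℂ} {t : ℝ} (hc : c ≠ 0)
    (hslit : a + t * c ∈ slitPlane) (hre : -1 < (log (a + t * c)).re) :
    ¬IsLocalMax (fun s : ℝ => ‖log (a + s * c)‖ ^ 2) t := by
  intro hmax
  set φ := fun s : ℝ => ‖log (a + s * c)‖ ^ 2
  have hd := hasDerivAt_norm_log_sq (hasDerivAt_line a c t) hslit
  have hcrit : inner ℝ (log (a + t * c)) (c / (a + t * c)) = 0 := by
    simpa using hmax.hasDerivAt_eq_zero hd
  have hpos : 0 < deriv (deriv φ) t := by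
    have hv : 0 < ‖c / (a + t * c)‖ ^ 2 :=
      pow_pos (norm_pos_iff.2 (div_ne_zero hc (slitPlane_ne_zero hslit))) 2
    rw [deriv_deriv_norm_log_sq_line hslit, sub_eq_add_neg, neg_inner_sq_eq_of_inner_eq_zero hcrit]
    nlinarith
  have hmin := isLocalMin_of_deriv_deriv_pos hpos hmax.deriv_eq_zero hd.continuousAt
  have hconst : φ =ᶠ[𝓝 t] fun _ => φ t := by
    filter_upwards [hmax, hmin] with s h₁ h₂ using le_antisymm h₁ h₂
  have hzero : deriv (deriv φ) t = 0 := by simp [hconst.deriv.deriv_eq]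
  exact hpos.ne' hzero

theorem exp_neg_one_lt_re_exp {ζ : ℂ} (hζ : ‖ζ‖ ≤ 1) (hne : ζ ≠ -1) :
    Real.exp (-1) < (exp ζ).re := by
  have hsq : ζ.re ^ 2 + ζ.im ^ 2 ≤ 1 := by
    have := pow_le_one₀ (n := 2) (norm_nonneg ζ) hζ
    rwa [Complex.sq_norm, normSq_apply, ← sq, ← sq] at this
  obtain ⟨u, hu⟩ : ∃ u, u = ζ.re + 1 := ⟨_, rfl⟩
  have hu0 : 0 < u := by
    refine lt_of_le_of_ne (by nlinarith) fun h => hne (Complex.ext ?_ ?_)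
    · rw [neg_re, one_re]; linarith
    · rw [neg_im, one_im]; nlinarith
  have hexp := Real.quadratic_le_exp_of_nonneg hu0.le
  have hcos : 1 - u + u ^ 2 / 2 ≤ Real.cos ζ.im := by
    nlinarith [Real.one_sub_sq_div_two_le_cos (x := ζ.im)]
  have hprod : 1 < Real.exp u * Real.cos ζ.im :=
    calc 1 < 1 + u ^ 4 / 4 := by linarith [pow_pos hu0 4]
      _ = (1 + u + u ^ 2 / 2) * (1 - u + u ^ 2 / 2) := by ring
      _ ≤ Real.exp u * Real.cos ζ.im :=
        mul_le_mul hexp hcos (by nlinarith [sq_nonneg (u - 1)]) (Real.exp_pos u).le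
  rw [exp_re, show ζ.re = -1 + u by linarith, Real.exp_add, mul_assoc]
  exact lt_mul_of_one_lt_right (Real.exp_pos _) hprod

theorem exp_neg_one_lt_re_of_mem_openSegment {a b w : ℂ} (ha : a ≠ 0) (hb : b ≠ 0)
    (hla : ‖log a‖ ≤ 1) (hlb : ‖log b‖ ≤ 1) (hab : a ≠ b) (hw : w ∈ openSegment ℝ a b) :
    Real.exp (-1) < w.re := by
  have hlt : ∀ z : ℂ, z ≠ 0 → ‖log z‖ ≤ 1 → log z ≠ -1 → Real.exp (-1) < z.re :=
    fun z hz hlz hne => by simpa only [exp_log hz] using exp_neg_one_lt_re_exp hlz hne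
  have hle : ∀ z : ℂ, z ≠ 0 → log z = -1 → Real.exp (-1) = z.re := fun z hz hlz => by
    rw [← exp_log hz, hlz, ← ofReal_one, ← ofReal_neg, exp_ofReal_re]
  obtain ⟨s, t, hs, ht, hst, rfl⟩ := hw
  obtain rfl : s = 1 - t := by linarith
  rw [add_re, smul_re, smul_re, smul_eq_mul, smul_eq_mul]
  by_cases h₁ : log a = -1 <;> by_cases h₂ : log b = -1
  · exact absurd ((exp_log ha).symm.trans (by rw [h₁, ← h₂, exp_log hb])) hab
  · nlinarith [hle a ha h₁, hlt b hb hlb h₂]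
  · nlinarith [hlt a ha hla h₁, hle b hb h₂]
  · nlinarith [hlt a ha hla h₁, hlt b hb hlb h₂]

theorem re_pos_of_norm_log_le_one {z : ℂ} (hz : z ≠ 0) (hlz : ‖log z‖ ≤ 1) : 0 < z.re := by
  have harg : |arg z| < Real.pi / 2 := by
    rw [← log_im]
    linarith [abs_im_le_norm (log z), Real.pi_gt_three]
  exact (abs_arg_lt_pi_div_two_iff.1 harg).resolve_right hz

theorem exists_isLocalMax_Ioo_of_endpoints_le {f : ℝ → ℝ} {a b c : ℝ}
    (hf : ContinuousOn f (Icc a b)) (hc : c ∈ Ioo a b) (ha : f a ≤ f c) (hb : f b ≤ f c) :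
    ∃ t ∈ Ioo a b, IsLocalMax f t := by
  obtain ⟨m, hm, hmax⟩ := isCompact_Icc.exists_isMaxOn ⟨c, Ioo_subset_Icc_self hc⟩ hf
  suffices h : ∃ t ∈ Ioo a b, f m ≤ f t by
    obtain ⟨t, ht, hmt⟩ := h
    exact ⟨t, ht, IsMaxOn.isLocalMax (fun s hs => (hmax hs).trans hmt) (Icc_mem_nhds ht.1 ht.2)⟩
  rcases eq_endpoints_or_mem_Ioo_of_mem_Icc hm with rfl | rfl | hm
  exacts [⟨c, hc, ha⟩, ⟨c, hc, hb⟩, ⟨m, hm, le_rfl⟩]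

theorem norm_log_lt_max_of_mem_openSegment {a b w : ℂ} (ha : a ≠ 0) (hb : b ≠ 0)
    (hla : ‖log a‖ ≤ 1) (hlb : ‖log b‖ ≤ 1) (hab : a ≠ b) (hw : w ∈ openSegment ℝ a b) :
    ‖log w‖ < max ‖log a‖ ‖log b‖ := by
  have hre : ∀ t ∈ Ioo (0 : ℝ) 1, Real.exp (-1) < (a + t * (b - a)).re := fun t ht =>
    exp_neg_one_lt_re_of_mem_openSegment ha hb hla hlb hab
      (by rw [openSegment_eq_image']; exact ⟨t, ht, by simp⟩)
  have hslit : ∀ t ∈ Icc (0 : ℝ) 1, a + t * (b - a) ∈ slitPlane := fun t ht => by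
    rcases eq_endpoints_or_mem_Ioo_of_mem_Icc ht with rfl | rfl | ht
    · rw [ofReal_zero, zero_mul, add_zero]
      exact Or.inl (re_pos_of_norm_log_le_one ha hla)
    · rw [ofReal_one, one_mul, add_sub_cancel]
      exact Or.inl (re_pos_of_norm_log_le_one hb hlb)
    · exact Or.inl ((Real.exp_pos _).trans (hre t ht))
  rw [openSegment_eq_image'] at hw
  obtain ⟨τ, hτ, rfl⟩ := hw
  by_contra! hmax
  rw [real_smul] at hmax
  obtain ⟨t, ht, hloc⟩ := exists_isLocalMax_Ioo_of_endpoints_le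
    (f := fun s : ℝ => ‖log (a + s * (b - a))‖ ^ 2) (fun s hs =>
      (hasDerivAt_norm_log_sq (hasDerivAt_line a _ s) (hslit s hs)).continuousAt.continuousWithinAt)
    hτ (by simpa using pow_le_pow_left₀ (norm_nonneg _) ((le_max_left _ _).trans hmax) 2)
    (by simpa using pow_le_pow_left₀ (norm_nonneg _) ((le_max_right _ _).trans hmax) 2)
  refine not_isLocalMax_norm_log_sq_line (sub_ne_zero.2 hab.symm)
    (hslit t (Ioo_subset_Icc_self ht)) ?_ hloc
  rw [log_re, Real.lt_log_iff_exp_lt (norm_pos_iff.2 (slitPlane_ne_zero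
    (hslit t (Ioo_subset_Icc_self ht))))]
  exact (hre t ht).trans_le (re_le_norm _)

theorem norm_log_conj (z : ℂ) : ‖log (conj z)‖ = ‖log z‖ := by
  rw [log_conj_eq_ite]
  split_ifs
  · rfl
  · exact norm_conj _

theorem norm_log_lt_of_re_eq_of_im_lt {z w : ℂ} (hz : z ≠ 0) (hlz : ‖log z‖ ≤ 1)
    (hre : w.re = z.re) (h0 : 0 ≤ w.im) (him : w.im < z.im) : ‖log w‖ < ‖log z‖ := by
  have hz0 : 0 < z.im := h0.trans_lt him
  have hne : conj z ≠ z := fun h => by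
    have := congrArg im h
    rw [conj_im] at this
    linarith
  have hw : w ∈ openSegment ℝ (conj z) z := by
    refine ⟨(1 - w.im / z.im) / 2, (1 + w.im / z.im) / 2, ?_, ?_, by ring, ?_⟩
    · linarith [(div_lt_one hz0).2 him]
    · linarith [div_nonneg h0 hz0.le]
    · apply Complex.ext
      · simp only [add_re, smul_re, conj_re, smul_eq_mul, hre]
        ring
      · simp only [add_im, smul_im, conj_im, smul_eq_mul]
        field_simp
        ring
  simpa only [norm_log_conj, max_self] using norm_log_lt_max_of_mem_openSegment
    ((map_ne_zero _).2 hz) hz ((norm_log_conj z).trans_le hlz) hlz hne hw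

theorem norm_log_combo_le_max {a b : ℂ} {s t : ℝ} (ha : a ≠ 0) (hb : b ≠ 0) (hla : ‖log a‖ ≤ 1)
    (hlb : ‖log b‖ ≤ 1) (hs : 0 < s) (ht : 0 < t) (hst : s + t = 1) :
    ‖log (s • a + t • b)‖ ≤ max ‖log a‖ ‖log b‖ := by
  rcases eq_or_ne a b with rfl | hab
  · rw [← add_smul, hst, one_smul, max_self]
  · exact (norm_log_lt_max_of_mem_openSegment ha hb hla hlb hab ⟨s, t, hs, ht, hst, rfl⟩).le

end StrictQuasiconvexity

section StrictConvexity

variable {E : Type*} [NormedAddCommGroup E] [InnerProductSpace ℝ E] {x y z w : E} {M : ℝ}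

theorem norm_logCoord_lt_max_of_mem_openSegment (hx : x ≠ 0) (hy : y ≠ 0) (hz : z ≠ 0)
    (hly : ‖logCoord x y‖ ≤ 1) (hlz : ‖logCoord x z‖ ≤ 1) (hyz : y ≠ z)
    (hw : w ∈ openSegment ℝ y z) :
    w ≠ 0 ∧ ‖logCoord x w‖ < max ‖logCoord x y‖ ‖logCoord x z‖ := by
  obtain ⟨s, t, hs, ht, hst, rfl⟩ := hw
  have hY := halfPlaneCoord_ne_zero hx hy
  have hZ := halfPlaneCoord_ne_zero hx hz
  obtain ⟨n, hn⟩ : ∃ n, n = s • halfPlaneCoord x y + t • halfPlaneCoord x z := ⟨_, rfl⟩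
  have hre : (halfPlaneCoord x (s • y + t • z)).re = n.re := hn ▸ halfPlaneCoord_combo_re x y z s t
  have him : (halfPlaneCoord x (s • y + t • z)).im ≤ n.im :=
    hn ▸ halfPlaneCoord_combo_im_le x y z hs.le ht.le
  have hn0 : 0 < n.re := by
    rw [hn, Complex.add_re, Complex.smul_re, Complex.smul_re]
    exact add_pos (smul_pos hs (re_pos_of_norm_log_le_one hY hly))
      (smul_pos ht (re_pos_of_norm_log_le_one hZ hlz))
  have hln : ‖Complex.log n‖ ≤ max ‖logCoord x y‖ ‖logCoord x z‖ :=
    hn ▸ norm_log_combo_le_max hY hZ hly hlz hs ht hst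
  have hlt : halfPlaneCoord x (s • y + t • z) ≠ n →
      ‖logCoord x (s • y + t • z)‖ < ‖Complex.log n‖ := fun hne =>
    norm_log_lt_of_re_eq_of_im_lt (fun h => hn0.ne' (by rw [h, Complex.zero_re]))
      (hln.trans (max_le hly hlz)) hre (halfPlaneCoord_im_nonneg x _)
      (him.lt_of_ne fun h => hne (Complex.ext hre h))
  refine ⟨fun h0 => hn0.ne' ?_, ?_⟩
  · rw [← hre, h0, ← zero_smul ℝ x, halfPlaneCoord_re_smul, zero_mul]
  rcases eq_or_ne (halfPlaneCoord x y) (halfPlaneCoord x z) with hYZ | hYZ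
  · have hyz' : ‖y‖ = ‖z‖ := (norm_halfPlaneCoord_inj hx).1 (congrArg norm hYZ)
    have hny : n = halfPlaneCoord x y := by rw [hn, ← hYZ, ← add_smul, hst, one_smul]
    refine (hlt fun h => ?_).trans_le hln
    exact (norm_combo_lt_of_ne le_rfl hyz'.ge hyz hs ht hst).ne
      ((norm_halfPlaneCoord_inj hx).1 (congrArg norm (h.trans hny)))
  · by_cases h : halfPlaneCoord x (s • y + t • z) = n
    · rw [logCoord, h, hn]
      exact norm_log_lt_max_of_mem_openSegment hY hZ hly hlz hYZ ⟨s, t, hs, ht, hst, rfl⟩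
    · exact (hlt h).trans_le hln

theorem isStrictlyConvex_logBall (hx : x ≠ 0) (hM : M ≤ 1) : IsStrictlyConvex (logBall x M) := by
  intro y hy z hz hyz w hw
  obtain ⟨hy0, hly⟩ := closure_logBall_subset hx hy
  obtain ⟨hz0, hlz⟩ := closure_logBall_subset hx hz
  obtain ⟨hw0, hlw⟩ := norm_logCoord_lt_max_of_mem_openSegment hx hy0 hz0 (hly.trans hM)
    (hlz.trans hM) hyz hw
  rw [(isOpen_logBall hx M).interior_eq]
  exact ⟨hw0, hlw.trans_le (max_le hly hlz)⟩

end StrictConvexity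

section NotConvex

variable {E : Type*} [NormedAddCommGroup E] [InnerProductSpace ℝ E] {x : E} {M : ℝ}

theorem exists_sq_add_sq_lt_sq (hM : 1 < M) :
    ∃ u ∈ Ioo 0 (Real.pi / 4), (-M + 2 * Real.sin u ^ 2) ^ 2 + (2 * u) ^ 2 < M ^ 2 := by
  have hcont : Continuous fun u => Real.sinc u ^ 2 * (M - Real.sin u ^ 2) := by fun_prop
  have hev : ∀ᶠ u in 𝓝[>] (0 : ℝ), 1 < Real.sinc u ^ 2 * (M - Real.sin u ^ 2) :=
    mem_nhdsWithin_of_mem_nhds (hcont.continuousAt.eventually (lt_mem_nhds (by simpa using hM)))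
  have hlt : ∀ᶠ u in 𝓝[>] (0 : ℝ), u ∈ Ioo 0 (Real.pi / 4) :=
    Ioo_mem_nhdsGT (by positivity)
  obtain ⟨u, hu, hmem⟩ := (hev.and hlt).exists
  refine ⟨u, hmem, ?_⟩
  have hsin : Real.sin u = u * Real.sinc u := by
    rw [Real.sinc_of_ne_zero hmem.1.ne', mul_div_cancel₀ _ hmem.1.ne']
  have hsq : u ^ 2 < Real.sin u ^ 2 * (M - Real.sin u ^ 2) :=
    calc u ^ 2 = u ^ 2 * 1 := (mul_one _).symm
      _ < u ^ 2 * (Real.sinc u ^ 2 * (M - Real.sin u ^ 2)) :=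
        mul_lt_mul_of_pos_left hu (pow_pos hmem.1 2)
      _ = Real.sin u ^ 2 * (M - Real.sin u ^ 2) := by rw [← mul_assoc, ← mul_pow, ← hsin]
  linarith

theorem planeEmbedding_add_planeEmbedding_neg (x e : E) (c : ℂ) :
    (1 / 2 : ℝ) • planeEmbedding x e c + (1 / 2 : ℝ) • planeEmbedding x (-e) c = c.re • x := by
  simp only [planeEmbedding_apply]
  module

theorem planeEmbedding_exp_mem_logBall {e : E} (hx : x ≠ 0) (he : inner ℝ x e = 0) (hn : ‖e‖ = ‖x‖)
    {ζ : ℂ} (h0 : 0 ≤ ζ.im) (hπ : ζ.im ≤ Real.pi) (hζ : ‖ζ‖ < M) :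
    planeEmbedding x e (Complex.exp ζ) ∈ logBall x M :=
  ⟨planeEmbedding_exp_ne_zero hx he hn ζ, by rwa [logCoord_planeEmbedding_exp hx he hn h0 hπ]⟩

theorem logCoord_smul_self (hx : x ≠ 0) {t : ℝ} (ht : 0 ≤ t) : logCoord x (t • x) = Real.log t := by
  have hcoord : halfPlaneCoord x (t • x) = t := by
    apply Complex.ext
    · rw [halfPlaneCoord_re_smul, halfPlaneCoord_self hx, Complex.one_re, mul_one,
        Complex.ofReal_re]
    · rw [halfPlaneCoord_im_smul, halfPlaneCoord_self hx, Complex.one_im, mul_zero,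
        Complex.ofReal_im]
  rw [logCoord, hcoord, Complex.ofReal_log ht]

/-- The points that `logCoord x` maps to `p + q i` form a sphere around the axis `ℝ x`. It bulges
out of the ball when `p` is slightly larger than `-M`, while its centre has the logarithmic
coordinate `p + log (cos q) ≤ -M`. -/
theorem not_convex_logBall (hE : 1 < Module.rank ℝ E) (hx : x ≠ 0) (hM : 1 < M) :
    ¬Convex ℝ (logBall x M) := by
  intro hconv
  obtain ⟨e, he, hn, -⟩ := exists_planeEmbedding_halfPlaneCoord_eq hE hx x
  obtain ⟨u, ⟨hu0, hu1⟩, hu⟩ := exists_sq_add_sq_lt_sq hM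
  set ζ : ℂ := ⟨-M + 2 * Real.sin u ^ 2, 2 * u⟩
  have hζ : ‖ζ‖ < M := by
    rw [← sq_lt_sq₀ (norm_nonneg _) (by linarith), Complex.sq_norm, Complex.normSq_mk, ← sq, ← sq]
    exact hu
  have hmem : ∀ e : E, inner ℝ x e = 0 → ‖e‖ = ‖x‖ →
      planeEmbedding x e (Complex.exp ζ) ∈ logBall x M := fun e he hn =>
    planeEmbedding_exp_mem_logBall hx he hn (by simp [ζ, hu0.le])
      (by simp only [ζ]; linarith [Real.pi_pos]) hζ
  have hmid := hconv (hmem e he hn) (hmem (-e) (by rw [inner_neg_right, he, neg_zero])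
    (by rw [norm_neg, hn])) one_half_pos.le one_half_pos.le (add_halves 1)
  have hcos : 0 < Real.cos (2 * u) :=
    Real.cos_pos_of_mem_Ioo ⟨by linarith [Real.pi_pos], by linarith⟩
  have hlog : Real.log (Complex.exp ζ).re ≤ -M := by
    rw [Complex.exp_re, Real.log_mul (Real.exp_pos _).ne' hcos.ne', Real.log_exp]
    have := Real.log_le_sub_one_of_pos hcos
    rw [Real.cos_two_mul, Real.cos_sq'] at this ⊢
    linarith
  have hre : 0 ≤ (Complex.exp ζ).re := by
    rw [Complex.exp_re]
    exact mul_nonneg (Real.exp_pos _).le hcos.le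
  rw [planeEmbedding_add_planeEmbedding_neg] at hmid
  have hlt := hmid.2
  rw [logCoord_smul_self hx hre, Complex.norm_real, Real.norm_eq_abs] at hlt
  linarith [neg_le_abs (Real.log (Complex.exp ζ).re)]

end NotConvex

section Kappa

/-- The function on the left-hand side of `KappaEquation`, in the variable `√(p ^ 2 - 1)`. -/
noncomputable def cosAddMulSin (s : ℝ) : ℝ :=
  Real.cos s + s * Real.sin s

theorem kappaEquation_iff (p : ℝ) :
    KappaEquation p ↔ cosAddMulSin √(p ^ 2 - 1) = Real.exp (-1) :=
  Iff.rfl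

theorem hasDerivAt_cosAddMulSin (s : ℝ) : HasDerivAt cosAddMulSin (s * Real.cos s) s := by
  refine ((Real.hasDerivAt_cos s).add
    ((hasDerivAt_id s).mul (Real.hasDerivAt_sin s))).congr_deriv ?_
  rw [id, one_mul, neg_add_cancel_left]

theorem continuous_cosAddMulSin : Continuous cosAddMulSin :=
  Real.continuous_cos.add (continuous_id.mul Real.continuous_sin)

theorem strictAntiOn_cosAddMulSin : StrictAntiOn cosAddMulSin (Icc (Real.pi / 2) Real.pi) := by
  refine strictAntiOn_of_deriv_neg (convex_Icc _ _) continuous_cosAddMulSin.continuousOn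
    fun s hs => ?_
  rw [interior_Icc] at hs
  rw [(hasDerivAt_cosAddMulSin s).deriv]
  exact mul_neg_of_pos_of_neg (by linarith [hs.1, Real.pi_pos])
    (Real.cos_neg_of_pi_div_two_lt_of_lt hs.1 (by linarith [hs.2, Real.pi_pos]))

theorem one_sub_cos_le_mul_sin {s : ℝ} (h0 : 0 ≤ s) (h1 : s ≤ Real.pi / 2) :
    1 - Real.cos s ≤ s * Real.sin s := by
  have hcos : 0 ≤ Real.cos s :=
    Real.cos_nonneg_of_neg_pi_div_two_le_of_le (by linarith [Real.pi_pos]) h1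
  have hsin : 0 ≤ Real.sin s := Real.sin_nonneg_of_nonneg_of_le_pi h0 (by linarith [Real.pi_pos])
  calc 1 - Real.cos s ≤ 1 - Real.cos s ^ 2 := by nlinarith [Real.cos_le_one s]
    _ = Real.sin s * Real.sin s := by rw [← Real.sin_sq, sq]
    _ ≤ s * Real.sin s := mul_le_mul_of_nonneg_right (Real.sin_le h0) hsin

theorem cosAddMulSin_lt_of_lt {s t : ℝ} (hs0 : 0 ≤ s) (hs : cosAddMulSin s < 1) (hst : s < t)
    (ht : t ≤ Real.pi) : cosAddMulSin t < cosAddMulSin s := by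
  have hs2 : Real.pi / 2 ≤ s := by
    by_contra! h
    have := one_sub_cos_le_mul_sin hs0 h.le
    rw [cosAddMulSin] at hs
    linarith
  exact strictAntiOn_cosAddMulSin ⟨hs2, hst.le.trans ht⟩ ⟨hs2.trans hst.le, ht⟩ hst

theorem sqrt_sq_sub_one_lt_sqrt_sq_sub_one {p q : ℝ} (hp : 1 ≤ p) (hpq : p < q) :
    √(p ^ 2 - 1) < √(q ^ 2 - 1) :=
  Real.sqrt_lt_sqrt (by nlinarith) (by nlinarith)

theorem sqrt_sq_sub_one_lt {p : ℝ} (hp : 0 < p) : √(p ^ 2 - 1) < p := by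
  rw [Real.sqrt_lt' hp]
  linarith

theorem cosAddMulSin_lt_exp_neg_one_of_lt {κ p : ℝ} (hκ : 1 ≤ κ) (hk : KappaEquation κ)
    (hκp : κ < p) (hp : p ≤ Real.pi) : cosAddMulSin √(p ^ 2 - 1) < Real.exp (-1) := by
  rw [kappaEquation_iff] at hk
  rw [← hk]
  exact cosAddMulSin_lt_of_lt (Real.sqrt_nonneg _)
    (hk.trans_lt (Real.exp_lt_one_iff.2 (by norm_num)))
    (sqrt_sq_sub_one_lt_sqrt_sq_sub_one hκ hκp) ((sqrt_sq_sub_one_lt (by linarith)).le.trans hp)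

theorem exp_neg_one_lt_cosAddMulSin_of_lt {κ p : ℝ} (hκ : κ ≤ Real.pi) (hk : KappaEquation κ)
    (hp : 1 ≤ p) (hpκ : p < κ) : Real.exp (-1) < cosAddMulSin √(p ^ 2 - 1) := by
  by_contra! hle
  have := cosAddMulSin_lt_of_lt (Real.sqrt_nonneg _)
    (hle.trans_lt (Real.exp_lt_one_iff.2 (by norm_num)))
    (sqrt_sq_sub_one_lt_sqrt_sq_sub_one hp hpκ) ((sqrt_sq_sub_one_lt (by linarith)).le.trans hκ)
  exact (this.trans_le hle).ne ((kappaEquation_iff κ).1 hk)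

theorem kappaEquation_unique {κ p : ℝ} (hκ : κ ∈ Icc 1 Real.pi) (hp : p ∈ Icc 1 Real.pi)
    (hk : KappaEquation κ) (hk' : KappaEquation p) : p = κ := by
  by_contra hne
  rcases lt_or_gt_of_ne hne with h | h
  · exact (exp_neg_one_lt_cosAddMulSin_of_lt hκ.2 hk hp.1 h).ne' ((kappaEquation_iff p).1 hk')
  · exact (cosAddMulSin_lt_exp_neg_one_of_lt hκ.1 hk h hp.2).ne ((kappaEquation_iff p).1 hk')

theorem exp_ofReal_mul_I_sub_sum_range_eight (x : ℝ) :
    Complex.exp (x * Complex.I) - ∑ m ∈ Finset.range 8, (x * Complex.I) ^ m / m.factorial =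
      ⟨Real.cos x - (1 - x ^ 2 / 2 + x ^ 4 / 24 - x ^ 6 / 720),
        Real.sin x - (x - x ^ 3 / 6 + x ^ 5 / 120 - x ^ 7 / 5040)⟩ := by
  have h2 : Complex.I ^ 2 = -1 := Complex.I_sq
  have h3 : Complex.I ^ 3 = -Complex.I := Complex.I_pow_three
  have h4 : Complex.I ^ 4 = 1 := Complex.I_pow_four
  have h5 : Complex.I ^ 5 = Complex.I := by rw [pow_succ, h4, one_mul]
  have h6 : Complex.I ^ 6 = -1 := by rw [pow_succ, h5, Complex.I_mul_I]
  have h7 : Complex.I ^ 7 = -Complex.I := by rw [pow_succ, h6, neg_one_mul]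
  rw [Complex.mk_eq_add_mul_I, Complex.exp_mul_I]
  simp only [Finset.sum_range_succ, Finset.sum_range_zero, mul_pow, h2, h3, h4, h5, h6, h7,
    Nat.factorial]
  push_cast
  ring

theorem norm_exp_ofReal_mul_I_sub_sum_range_eight_le {x : ℝ} (hx : |x| ≤ 1) :
    ‖Complex.exp (x * Complex.I) - ∑ m ∈ Finset.range 8, (x * Complex.I) ^ m / m.factorial‖ ≤
      x ^ 8 / 35840 := by
  have hnorm : ‖(x * Complex.I : ℂ)‖ = |x| := by simp
  refine (Complex.exp_bound (hnorm.trans_le hx) (n := 8) (by norm_num)).trans_eq ?_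
  rw [hnorm, (show Even 8 by decide).pow_abs]
  norm_num [Nat.factorial]
  ring

theorem abs_cos_sub_taylor_le {x : ℝ} (hx : |x| ≤ 1) :
    |Real.cos x - (1 - x ^ 2 / 2 + x ^ 4 / 24 - x ^ 6 / 720)| ≤ x ^ 8 / 35840 := by
  simpa only [exp_ofReal_mul_I_sub_sum_range_eight] using
    (Complex.abs_re_le_norm _).trans (norm_exp_ofReal_mul_I_sub_sum_range_eight_le hx)

theorem abs_sin_sub_taylor_le {x : ℝ} (hx : |x| ≤ 1) :
    |Real.sin x - (x - x ^ 3 / 6 + x ^ 5 / 120 - x ^ 7 / 5040)| ≤ x ^ 8 / 35840 := by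
  simpa only [exp_ofReal_mul_I_sub_sum_range_eight] using
    (Complex.abs_im_le_norm _).trans (norm_exp_ofReal_mul_I_sub_sum_range_eight_le hx)

theorem cosAddMulSin_eq_pi_sub (s : ℝ) :
    cosAddMulSin s = s * Real.sin (Real.pi - s) - Real.cos (Real.pi - s) := by
  rw [Real.sin_pi_sub, Real.cos_pi_sub, cosAddMulSin]
  ring

theorem exp_neg_one_lt_cosAddMulSin : Real.exp (-1) < cosAddMulSin 2.650603 := by
  have hpi := Real.pi_gt_d6
  have hpi' := Real.pi_lt_d6
  have hsin : Real.sin 0.490989 ≤ Real.sin (Real.pi - 2.650603) :=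
    Real.sin_le_sin_of_le_of_le_pi_div_two (by linarith) (by linarith) (by linarith)
  have hcos : Real.cos (Real.pi - 2.650603) ≤ Real.cos 0.490989 :=
    Real.cos_le_cos_of_nonneg_of_le_pi (by norm_num) (by linarith) (by linarith)
  have hcos' := (abs_le.1 (abs_cos_sub_taylor_le (x := 0.490989) (by norm_num))).2
  have hsin' := (abs_le.1 (abs_sin_sub_taylor_le (x := 0.490989) (by norm_num))).1
  rw [cosAddMulSin_eq_pi_sub]
  linarith [Real.exp_neg_one_lt_d9]

theorem cosAddMulSin_lt_exp_neg_one : cosAddMulSin 2.650612 < Real.exp (-1) := by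
  have hpi := Real.pi_gt_d6
  have hpi' := Real.pi_lt_d6
  have hsin : Real.sin (Real.pi - 2.650612) ≤ Real.sin 0.490981 :=
    Real.sin_le_sin_of_le_of_le_pi_div_two (by linarith) (by linarith) (by linarith)
  have hcos : Real.cos 0.490981 ≤ Real.cos (Real.pi - 2.650612) :=
    Real.cos_le_cos_of_nonneg_of_le_pi (by linarith) (by linarith) (by linarith)
  have hcos' := (abs_le.1 (abs_cos_sub_taylor_le (x := 0.490981) (by norm_num))).1
  have hsin' := (abs_le.1 (abs_sin_sub_taylor_le (x := 0.490981) (by norm_num))).2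
  rw [cosAddMulSin_eq_pi_sub]
  linarith [Real.exp_neg_one_gt_d9]

theorem exists_kappaEquation :
    ∃ κ ∈ Icc 1 Real.pi, KappaEquation κ ∧ |κ - 2.83297| ≤ 0.000005 := by
  obtain ⟨s, hs, hsk⟩ := intermediate_value_Icc' (show (2.650603 : ℝ) ≤ 2.650612 by norm_num)
    continuous_cosAddMulSin.continuousOn
    ⟨cosAddMulSin_lt_exp_neg_one.le, exp_neg_one_lt_cosAddMulSin.le⟩
  have hlower : 2.832965 ≤ √(s ^ 2 + 1) := Real.le_sqrt_of_sq_le (by nlinarith [hs.1])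
  have hupper : √(s ^ 2 + 1) ≤ 2.832975 :=
    (Real.sqrt_le_left (by norm_num)).2 (by nlinarith [hs.1, hs.2])
  refine ⟨√(s ^ 2 + 1), ⟨by linarith, by linarith [Real.pi_gt_three]⟩, ?_,
    abs_le.2 ⟨by linarith, by linarith⟩⟩
  rw [kappaEquation_iff, Real.sq_sqrt (by positivity), add_sub_cancel_right,
    Real.sqrt_sq (by linarith [hs.1])]
  exact hsk

theorem lt_pi_of_kappaEquation {κ : ℝ} (hκ : κ ∈ Icc 1 Real.pi) (hk : KappaEquation κ) :
    κ < Real.pi := by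
  obtain ⟨p, hp, hpk, habs⟩ := exists_kappaEquation
  rw [← kappaEquation_unique hκ hp hk hpk]
  linarith [(abs_le.1 habs).2, Real.pi_gt_three]

end Kappa

section RadialDerivative

open Complex ComplexConjugate

theorem sin_le_sin_add_cos_mul_sub {t u : ℝ} (ht : t ∈ Icc 0 Real.pi) (hu : u ∈ Icc 0 Real.pi) :
    Real.sin t ≤ Real.sin u + Real.cos u * (t - u) := by
  have hconc := strictConcaveOn_sin_Icc.concaveOn
  rcases lt_trichotomy t u with h | rfl | h
  · have := hconc.le_slope_of_hasDerivAt ht hu h (Real.hasDerivAt_sin u)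
    rw [slope_def_field, le_div_iff₀ (sub_pos.2 h)] at this
    linarith
  · rw [sub_self, mul_zero, add_zero]
  · have := hconc.slope_le_of_hasDerivAt hu ht h (Real.hasDerivAt_sin u)
    rw [slope_def_field, div_le_iff₀ (sub_pos.2 h)] at this
    linarith

theorem norm_mk_neg_one_sqrt_sq_sub_one {p : ℝ} (hp : 1 ≤ p) :
    ‖(⟨-1, √(p ^ 2 - 1)⟩ : ℂ)‖ = p := by
  rw [← sq_eq_sq₀ (norm_nonneg _) (by linarith), Complex.sq_norm, normSq_mk,
    Real.mul_self_sqrt (by nlinarith)]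
  ring

theorem re_mul_cos_add_im_mul_sin (w : ℂ) (θ : ℝ) :
    w.re * Real.cos θ + w.im * Real.sin θ = ‖w‖ * Real.cos (θ - arg w) := by
  rw [← norm_mul_cos_arg w, ← norm_mul_sin_arg w, Real.cos_sub]
  ring

-- With `w.re = ‖w‖ cos t` and `w.im = ‖w‖ sin t`, the right-hand side is `‖w‖ cos (‖w‖ sin t - t)`,
-- and `‖w‖ sin t - t` is largest where `‖w‖ cos t = 1`.
theorem cosAddMulSin_sqrt_sq_norm_sub_one_le {w : ℂ} (hre : 0 ≤ w.re) (him : Real.pi / 2 ≤ w.im)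
    (hw : ‖w‖ ≤ Real.pi) :
    cosAddMulSin √(‖w‖ ^ 2 - 1) ≤ w.re * Real.cos w.im + w.im * Real.sin w.im := by
  have hπ := Real.pi_gt_three
  have hw1 : 1 ≤ ‖w‖ := by linarith [(le_abs_self _).trans (abs_im_le_norm w)]
  have hs0 := Real.sqrt_nonneg (‖w‖ ^ 2 - 1)
  have hsw : √(‖w‖ ^ 2 - 1) ≤ Real.pi := (sqrt_sq_sub_one_lt (by linarith)).le.trans hw
  obtain ⟨z, hzre, hzim⟩ : ∃ z : ℂ, z.re = 1 ∧ z.im = √(‖w‖ ^ 2 - 1) := ⟨⟨1, _⟩, rfl, rfl⟩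
  have hzw : ‖z‖ = ‖w‖ := by
    rw [← sq_eq_sq₀ (norm_nonneg _) (norm_nonneg _), Complex.sq_norm, normSq_apply, hzre, hzim,
      Real.mul_self_sqrt (by nlinarith)]
    ring
  rw [← hzim] at hs0 hsw
  have hargz : 0 ≤ arg z := arg_nonneg_iff.2 hs0
  have hargw : 0 ≤ arg w := arg_nonneg_iff.2 (by linarith)
  have hargw' : arg w ≤ Real.pi / 2 :=
    (le_abs_self _).trans (abs_arg_le_pi_div_two_iff.2 hre)
  have htangent : w.im - arg w ≤ z.im - arg z := by
    have := mul_le_mul_of_nonneg_left (sin_le_sin_add_cos_mul_sub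
      ⟨hargw, arg_le_pi w⟩ ⟨hargz, arg_le_pi z⟩) (norm_nonneg w)
    rw [mul_add, ← mul_assoc, norm_mul_sin_arg, ← hzw, norm_mul_sin_arg, norm_mul_cos_arg, hzre]
      at this
    linarith
  have hcos := Real.cos_le_cos_of_nonneg_of_le_pi (by linarith) (by linarith) htangent
  calc cosAddMulSin √(‖w‖ ^ 2 - 1)
      = ‖w‖ * Real.cos (z.im - arg z) := by
        rw [← hzw, ← re_mul_cos_add_im_mul_sin, hzre, one_mul, hzw, ← hzim, cosAddMulSin]
    _ ≤ ‖w‖ * Real.cos (w.im - arg w) := mul_le_mul_of_nonneg_left hcos (norm_nonneg w)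
    _ = _ := (re_mul_cos_add_im_mul_sin w w.im).symm

theorem neg_exp_neg_one_lt_mul_exp {r : ℝ} (hr : r ≠ -1) : -Real.exp (-1) < r * Real.exp r := by
  have hlt : -r < Real.exp (-1 - r) := by
    linarith [Real.add_one_lt_exp (x := -1 - r) fun h => hr (by linarith)]
  rw [Real.exp_sub, lt_div_iff₀ (Real.exp_pos r)] at hlt
  linarith

theorem neg_exp_neg_one_le_mul_exp (r : ℝ) : -Real.exp (-1) ≤ r * Real.exp r := by
  rcases eq_or_ne r (-1) with rfl | hr
  · rw [neg_one_mul]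
  · exact (neg_exp_neg_one_lt_mul_exp hr).le

theorem exp_re_mul_inner_one_sub_exp_neg (ζ : ℂ) :
    Real.exp ζ.re * inner ℝ ζ (1 - exp (-ζ)) =
      ζ.re * Real.exp ζ.re - ζ.re * Real.cos ζ.im + ζ.im * Real.sin ζ.im := by
  have hexp : Real.exp ζ.re * Real.exp (-ζ.re) = 1 := by
    rw [← Real.exp_add, add_neg_cancel, Real.exp_zero]
  simp only [Complex.inner, mul_re, conj_re, conj_im, sub_re, sub_im, one_re, one_im, exp_re,
    exp_im, neg_re, neg_im, Real.cos_neg, Real.sin_neg]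
  linear_combination (ζ.im * Real.sin ζ.im - ζ.re * Real.cos ζ.im) * hexp

theorem inner_one_sub_exp_neg_pos_of_re_nonneg {ζ : ℂ} (hζ : ζ ≠ 0) (hre : 0 ≤ ζ.re)
    (h0 : 0 ≤ ζ.im) (hπ : ζ.im < Real.pi) : 0 < inner ℝ ζ (1 - exp (-ζ)) := by
  rw [← mul_pos_iff_of_pos_left (Real.exp_pos ζ.re), exp_re_mul_inner_one_sub_exp_neg]
  have hsin : 0 ≤ Real.sin ζ.im := Real.sin_nonneg_of_nonneg_of_le_pi h0 hπ.le
  rcases hre.eq_or_lt with hre | hre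
  · have him : 0 < ζ.im := h0.lt_of_ne fun him => hζ (Complex.ext hre.symm him.symm)
    rw [← hre, zero_mul, zero_mul, sub_zero, zero_add]
    exact mul_pos him (Real.sin_pos_of_pos_of_lt_pi him hπ)
  · have hexp : 0 < Real.exp ζ.re - Real.cos ζ.im := by
      linarith [Real.one_lt_exp_iff.2 hre, Real.cos_le_one ζ.im]
    linarith [mul_pos hre hexp, mul_nonneg h0 hsin]

theorem inner_one_sub_exp_neg_pos_of_im_le_pi_div_two {ζ : ℂ} (hre : ζ.re < 0) (h0 : 0 ≤ ζ.im)
    (hπ : ζ.im ≤ Real.pi / 2) : 0 < inner ℝ ζ (1 - exp (-ζ)) := by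
  rw [← mul_pos_iff_of_pos_left (Real.exp_pos ζ.re), exp_re_mul_inner_one_sub_exp_neg]
  have hcos : 0 ≤ Real.cos ζ.im :=
    Real.cos_nonneg_of_neg_pi_div_two_le_of_le (by linarith [Real.pi_pos]) hπ
  have hvert : 0 < 1 + ζ.re * Real.exp ζ.re := by
    linarith [neg_exp_neg_one_le_mul_exp ζ.re, Real.exp_lt_one_iff.2 (neg_one_lt_zero (R := ℝ))]
  have hhor : 0 < ζ.re * (Real.exp ζ.re - 1) :=
    mul_pos_of_neg_of_neg hre (by linarith [Real.exp_lt_one_iff.2 hre])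
  have hcombo : 0 < (1 - Real.cos ζ.im) * (1 + ζ.re * Real.exp ζ.re) +
      Real.cos ζ.im * (ζ.re * (Real.exp ζ.re - 1)) := by
    rcases hcos.eq_or_lt with h | h
    · rw [← h]
      linarith
    · exact add_pos_of_nonneg_of_pos
        (mul_nonneg (sub_nonneg.2 (Real.cos_le_one _)) hvert.le) (mul_pos h hhor)
  linarith [one_sub_cos_le_mul_sin h0 hπ]

variable {κ : ℝ}

theorem inner_one_sub_exp_neg_pos_of_pi_div_two_le_im (hκ : κ ∈ Icc 1 Real.pi)
    (hk : KappaEquation κ) {ζ : ℂ} (hre : ζ.re ≤ 0) (him : Real.pi / 2 ≤ ζ.im) (hζ : ‖ζ‖ ≤ κ)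
    (hne : ζ ≠ ⟨-1, √(κ ^ 2 - 1)⟩) : 0 < inner ℝ ζ (1 - exp (-ζ)) := by
  rw [← mul_pos_iff_of_pos_left (Real.exp_pos ζ.re), exp_re_mul_inner_one_sub_exp_neg]
  have hπ := Real.pi_gt_three
  have hmin := cosAddMulSin_sqrt_sq_norm_sub_one_le (w := -conj ζ) (by simpa using hre)
    (by simpa using him) (by simpa using hζ.trans hκ.2)
  simp only [norm_neg, norm_conj, neg_re, neg_im, conj_re, conj_im, neg_neg, neg_mul] at hmin
  rcases hζ.lt_or_eq with hlt | rfl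
  · have hζ1 : 1 ≤ ‖ζ‖ := by linarith [(le_abs_self _).trans (abs_im_le_norm ζ)]
    linarith [exp_neg_one_lt_cosAddMulSin_of_lt hκ.2 hk hζ1 hlt,
      neg_exp_neg_one_le_mul_exp ζ.re]
  · have hre1 : ζ.re ≠ -1 := fun h => hne (Complex.ext h (by
      rw [Complex.sq_norm, normSq_apply, h]
      ring_nf
      exact (Real.sqrt_sq (by linarith)).symm))
    linarith [neg_exp_neg_one_lt_mul_exp hre1, (kappaEquation_iff _).1 hk]

theorem inner_one_sub_exp_neg_pos (hκ : κ ∈ Icc 1 Real.pi) (hk : KappaEquation κ) {ζ : ℂ}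
    (hζ0 : ζ ≠ 0) (him : 0 ≤ ζ.im) (hζ : ‖ζ‖ ≤ κ) (hne : ζ ≠ ⟨-1, √(κ ^ 2 - 1)⟩) :
    0 < inner ℝ ζ (1 - exp (-ζ)) := by
  have hπ : ζ.im < Real.pi :=
    ((le_abs_self _).trans (abs_im_le_norm ζ)).trans_lt (hζ.trans_lt (lt_pi_of_kappaEquation hκ hk))
  rcases le_or_gt 0 ζ.re with hre | hre
  · exact inner_one_sub_exp_neg_pos_of_re_nonneg hζ0 hre him hπ
  rcases le_total ζ.im (Real.pi / 2) with him' | him'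
  · exact inner_one_sub_exp_neg_pos_of_im_le_pi_div_two hre him him'
  · exact inner_one_sub_exp_neg_pos_of_pi_div_two_le_im hκ hk hre.le him' hζ hne

theorem inner_one_sub_exp_neg_neg (hκ : 1 ≤ κ) (hk : KappaEquation κ) {p : ℝ} (hκp : κ < p)
    (hp : p ≤ Real.pi) :
    inner ℝ (⟨-1, √(p ^ 2 - 1)⟩ : ℂ) (1 - exp (-⟨-1, √(p ^ 2 - 1)⟩)) < 0 := by
  have hlt := cosAddMulSin_lt_exp_neg_one_of_lt hκ hk hκp hp
  rw [cosAddMulSin] at hlt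
  refine neg_of_mul_neg_right ((exp_re_mul_inner_one_sub_exp_neg _).trans_lt ?_)
    (Real.exp_pos (-1)).le
  linarith

theorem mul_inner_log_div {c : ℂ} {t : ℝ} (hn : 1 + t * c ≠ 0) :
    t * inner ℝ (log (1 + t * c)) (c / (1 + t * c)) =
      inner ℝ (log (1 + t * c)) (1 - exp (-log (1 + t * c))) := by
  rw [← inner_smul_right, exp_neg, exp_log hn, real_smul]
  congr 1
  field_simp
  ring

theorem mem_slitPlane_of_norm_log_lt_pi {z : ℂ} (hz : z ≠ 0) (hlz : ‖log z‖ < Real.pi) :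
    z ∈ slitPlane :=
  mem_slitPlane_iff_arg.2 ⟨fun h => ((le_abs_self _).trans (abs_im_le_norm (log z))).not_gt
    (by rwa [log_im, h]), hz⟩

theorem inner_log_div_pos (hκ : κ ∈ Icc 1 Real.pi) (hk : KappaEquation κ) {c : ℂ} (hc : c ≠ 0)
    (hci : 0 ≤ c.im) {t : ℝ} (ht : 0 < t) (hn : 1 + t * c ≠ 0) (hlog : ‖log (1 + t * c)‖ ≤ κ)
    (hne : log (1 + t * c) ≠ ⟨-1, √(κ ^ 2 - 1)⟩) :
    0 < inner ℝ (log (1 + t * c)) (c / (1 + t * c)) := by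
  have htc : (t : ℂ) * c ≠ 0 := mul_ne_zero (ofReal_ne_zero.2 ht.ne') hc
  have hlog0 : log (1 + t * c) ≠ 0 := fun h => htc <| by
    rw [← add_eq_left (a := (1 : ℂ)), ← exp_log hn, h, exp_zero]
  have him : 0 ≤ (log (1 + t * c)).im := by
    rw [log_im, arg_nonneg_iff, add_im, one_im, zero_add, im_ofReal_mul]
    exact mul_nonneg ht.le hci
  rw [← mul_pos_iff_of_pos_left ht, mul_inner_log_div hn]
  exact inner_one_sub_exp_neg_pos hκ hk hlog0 him hlog hne

end RadialDerivative

section RadialMonotonicity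

theorem sub_mul_nonneg_of_isLocalMinOn {f : ℝ → ℝ} {s : Set ℝ} {a b d : ℝ}
    (hmin : IsLocalMinOn f s a) (hd : HasDerivAt f d a) (hs : segment ℝ a b ⊆ s) :
    0 ≤ (b - a) * d := by
  simpa using hmin.hasFDerivWithinAt_nonneg hd.hasFDerivAt.hasFDerivWithinAt
    (sub_mem_posTangentConeAt_of_segment_subset hs)

theorem lt_of_deriv_pos_of_le_right {f f' : ℝ → ℝ} {a b : ℝ} (hab : a < b)
    (hf : ∀ t ∈ Icc a b, HasDerivAt f (f' t) t) (hpos : ∀ t ∈ Ioc a b, f t ≤ f b → 0 < f' t) :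
    f a < f b := by
  by_contra! hba
  have hcont : ContinuousOn f (Icc a b) := fun t ht => (hf t ht).continuousAt.continuousWithinAt
  obtain ⟨m, hm, hmin⟩ : ∃ m ∈ Ioc a b, IsMinOn f (Icc a b) m := by
    obtain ⟨m, hm, hmin⟩ := isCompact_Icc.exists_isMinOn (nonempty_Icc.2 hab.le) hcont
    rcases hm.1.eq_or_lt with rfl | ham
    · exact ⟨b, right_mem_Ioc.2 hab, fun t ht => hba.trans (hmin ht)⟩
    · exact ⟨m, ⟨ham, hm.2⟩, hmin⟩
  have hseg : segment ℝ m a ⊆ Icc a b :=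
    (convex_Icc a b).segment_subset (Ioc_subset_Icc_self hm) (left_mem_Icc.2 hab.le)
  have hd := sub_mul_nonneg_of_isLocalMinOn hmin.localize (hf m (Ioc_subset_Icc_self hm)) hseg
  nlinarith [hpos m hm (hmin (right_mem_Icc.2 hab.le)), hm.1]

open Complex

variable {κ : ℝ} {c : ℂ}

theorem hasDerivAt_norm_log_sq_one_add_mul {t : ℝ} (hslit : 1 + t * c ∈ slitPlane) :
    HasDerivAt (fun s : ℝ => ‖log (1 + s * c)‖ ^ 2)
      (2 * inner ℝ (log (1 + t * c)) (c / (1 + t * c))) t :=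
  hasDerivAt_norm_log_sq (hasDerivAt_line 1 c t) hslit

theorem one_add_mul_mem_slitPlane (hc : 1 + c ∈ slitPlane) {t : ℝ} (ht : t ∈ Icc 0 1) :
    1 + t * c ∈ slitPlane :=
  starConvex_one_slitPlane.add_smul_mem hc ht.1 ht.2

theorem norm_log_one_add_mul_le (hκ : κ ∈ Icc 1 Real.pi) (hk : KappaEquation κ) (hci : 0 ≤ c.im)
    (hc : 1 + c ∈ slitPlane) (hlog : ‖log (1 + c)‖ < κ) {t : ℝ} (ht : t ∈ Icc 0 1) :
    ‖log (1 + t * c)‖ ≤ ‖log (1 + c)‖ := by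
  rcases eq_or_ne c 0 with rfl | hc0
  · rw [mul_zero]
  rcases ht.2.eq_or_lt with rfl | ht1
  · rw [ofReal_one, one_mul]
  have hlt := lt_of_deriv_pos_of_le_right ht1
    (fun s hs => hasDerivAt_norm_log_sq_one_add_mul
      (one_add_mul_mem_slitPlane hc ⟨ht.1.trans hs.1, hs.2⟩))
    fun s hs hle => ?_
  · rw [ofReal_one, one_mul, sq_lt_sq₀ (norm_nonneg _) (norm_nonneg _)] at hlt
    exact hlt.le
  · rw [ofReal_one, one_mul, sq_le_sq₀ (norm_nonneg _) (norm_nonneg _)] at hle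
    have hs0 : 0 < s := ht.1.trans_lt hs.1
    have hlogs := hle.trans_lt hlog
    refine mul_pos two_pos (inner_log_div_pos hκ hk hc0 hci hs0
      (slitPlane_ne_zero (one_add_mul_mem_slitPlane hc ⟨hs0.le, hs.2⟩)) hlogs.le fun h => ?_)
    rw [h, norm_mk_neg_one_sqrt_sq_sub_one hκ.1] at hlogs
    exact lt_irrefl _ hlogs

theorem strictMonoOn_norm_log_sq_one_add_mul (hκ : κ ∈ Icc 1 Real.pi) (hk : KappaEquation κ)
    (hc0 : c ≠ 0) (hci : 0 ≤ c.im) {a b : ℝ} (ha : 0 ≤ a)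
    (hray : ∀ t : ℝ, t ∈ Icc a b → 1 + t * c ≠ 0 ∧ ‖log (1 + t * c)‖ ≤ κ)
    (hne : ∀ t : ℝ, t ∈ Ioo a b → log (1 + t * c) ≠ ⟨-1, √(κ ^ 2 - 1)⟩) :
    StrictMonoOn (fun t : ℝ => ‖log (1 + t * c)‖ ^ 2) (Icc a b) := by
  have hderiv : ∀ t : ℝ, t ∈ Icc a b → HasDerivAt (fun s : ℝ => ‖log (1 + s * c)‖ ^ 2)
      (2 * inner ℝ (log (1 + t * c)) (c / (1 + t * c))) t := fun t ht =>
    hasDerivAt_norm_log_sq_one_add_mul (mem_slitPlane_of_norm_log_lt_pi (hray t ht).1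
      ((hray t ht).2.trans_lt (lt_pi_of_kappaEquation hκ hk)))
  refine strictMonoOn_of_deriv_pos (convex_Icc a b)
    (fun t ht => (hderiv t ht).continuousAt.continuousWithinAt) fun t ht => ?_
  rw [interior_Icc] at ht
  have ht' := Ioo_subset_Icc_self ht
  rw [(hderiv t ht').deriv]
  exact mul_pos two_pos (inner_log_div_pos hκ hk hc0 hci (ha.trans_lt ht.1) (hray t ht').1
    (hray t ht').2 (hne t ht))

-- A point of the open segment with `‖log‖ = M` is critical, so it is the only point of the ray
-- with logarithm `-1 + i √(κ ^ 2 - 1)`; hence `‖log‖` is strictly increasing beyond it.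
theorem norm_log_one_add_mul_lt (hκ : κ ∈ Icc 1 Real.pi) (hk : KappaEquation κ) (hc0 : c ≠ 0)
    (hci : 0 ≤ c.im) {M : ℝ} (hM0 : 0 < M) (hM : M ≤ κ)
    (hray : ∀ t : ℝ, t ∈ Icc 0 1 → 1 + t * c ≠ 0 ∧ ‖log (1 + t * c)‖ ≤ M)
    {t : ℝ} (ht : t ∈ Ico 0 1) : ‖log (1 + t * c)‖ < M := by
  have ht' := Ico_subset_Icc_self ht
  refine (hray t ht').2.lt_of_ne fun hlog => ?_
  have ht0 : 0 < t := ht.1.lt_of_ne fun h => by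
    rw [← h, ofReal_zero, zero_mul, add_zero, log_one, norm_zero] at hlog
    exact hM0.ne hlog
  have hmax : IsLocalMax (fun s : ℝ => ‖log (1 + s * c)‖ ^ 2) t := by
    filter_upwards [Icc_mem_nhds ht0 ht.2] with s hs
    rw [hlog]
    exact pow_le_pow_left₀ (norm_nonneg _) (hray s hs).2 2
  have hcrit : log (1 + t * c) = ⟨-1, √(κ ^ 2 - 1)⟩ := by
    by_contra hne
    have hpos := inner_log_div_pos hκ hk hc0 hci ht0 (hray t ht').1 (hlog.trans_le hM) hne
    have hslit := mem_slitPlane_of_norm_log_lt_pi (hray t ht').1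
      ((hlog.trans_le hM).trans_lt (lt_pi_of_kappaEquation hκ hk))
    linarith [hmax.hasDerivAt_eq_zero (hasDerivAt_norm_log_sq_one_add_mul hslit)]
  have hinj : ∀ s : ℝ, s ∈ Ioo t 1 → log (1 + s * c) ≠ ⟨-1, √(κ ^ 2 - 1)⟩ := fun s hs h => by
    have hexp := congrArg exp (hcrit.trans h.symm)
    rw [exp_log (hray t ht').1, exp_log (hray s ⟨ht.1.trans hs.1.le, hs.2.le⟩).1, add_right_inj,
      mul_left_inj' hc0, ofReal_inj] at hexp
    exact hs.1.ne hexp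
  have hlt := strictMonoOn_norm_log_sq_one_add_mul hκ hk hc0 hci ht.1
    (fun s hs => (hray s ⟨ht.1.trans hs.1, hs.2⟩).imp_right (le_trans · hM)) hinj
    (left_mem_Icc.2 ht.2.le) (right_mem_Icc.2 ht.2.le) ht.2
  dsimp only at hlt
  rw [hlog] at hlt
  exact hlt.not_ge (pow_le_pow_left₀ (norm_nonneg _) (hray 1 (right_mem_Icc.2 zero_le_one)).2 2)

end RadialMonotonicity

section Starlikeness

section NormedSpace

variable {E : Type*} [NormedAddCommGroup E] [NormedSpace ℝ E] {S : Set E} {x : E}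

theorem exists_mem_frontier_add_smul (hb : Bornology.IsBounded S) (hx : x ∈ S) {v : E}
    (hv : v ≠ 0) : ∃ t : ℝ, 0 ≤ t ∧ x + t • v ∈ frontier S := by
  have hcont : Continuous fun t : ℝ => x + |t| • v := by fun_prop
  have hne_univ : (fun t : ℝ => x + |t| • v) ⁻¹' S ≠ univ := fun huniv => by
    obtain ⟨C, hC⟩ := isBounded_iff_forall_norm_le.1 hb
    set r : ℝ := (C + ‖x‖ + 1) / ‖v‖
    have hr : ‖|r| • v‖ = |C + ‖x‖ + 1| := by
      rw [norm_smul, Real.norm_eq_abs, abs_abs, abs_div, abs_norm,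
        div_mul_cancel₀ _ (norm_ne_zero_iff.2 hv)]
    have hmem : x + |r| • v ∈ S := huniv.ge (mem_univ r)
    have hle := norm_sub_le (x + |r| • v) x
    rw [add_sub_cancel_left, hr] at hle
    linarith [hC _ hmem, le_abs_self (C + ‖x‖ + 1)]
  obtain ⟨t, ht⟩ := nonempty_frontier_iff.2 ⟨⟨0, by simpa using hx⟩, hne_univ⟩
  exact ⟨|t|, abs_nonneg t, hcont.frontier_preimage_subset S ht⟩

theorem isStrictlyStarlike_of_add_smul_sub_mem (ho : IsOpen S) (hb : Bornology.IsBounded S)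
    (hx : x ∈ S) (hS : ∀ z ∈ closure S, ∀ t : ℝ, t ∈ Ico 0 1 → x + t • (z - x) ∈ S) :
    IsStrictlyStarlike x S := by
  have hstar : StarConvex ℝ x S := by
    refine starConvex_iff_forall_pos hx |>.2 fun z hz a b ha hb hab => ?_
    obtain rfl : a = 1 - b := by linarith
    convert hS z (subset_closure hz) b ⟨hb.le, by linarith⟩ using 1
    module
  have hray : ∀ v : E, ∀ a b : ℝ, 0 ≤ a → a < b → x + a • v ∈ frontier S →
      x + b • v ∉ frontier S := fun v a b ha hab hfa hfb => by
    have hb0 : 0 < b := ha.trans_lt hab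
    have hmem := hS _ hfb.1 (a / b) ⟨div_nonneg ha hb0.le, (div_lt_one hb0).2 hab⟩
    rw [add_sub_cancel_left, smul_smul, div_mul_cancel₀ _ hb0.ne'] at hmem
    rw [ho.frontier_eq] at hfa
    exact hfa.2 hmem
  refine ⟨ho, (hstar.isPathConnected hx).isConnected, hx, hb, fun v hv => ?_⟩
  obtain ⟨t, ht, hf⟩ := exists_mem_frontier_add_smul hb hx hv
  refine ⟨x + t • v, ⟨hf, t, ht, rfl⟩, ?_⟩
  rintro _ ⟨hf', s, hs, rfl⟩
  rcases lt_trichotomy s t with h | rfl | h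
  · exact absurd hf (hray v s t hs h hf')
  · rfl
  · exact absurd hf' (hray v t s ht h hf)

end NormedSpace

variable {E : Type*} [NormedAddCommGroup E] [InnerProductSpace ℝ E] {x z : E} {κ M : ℝ}

theorem starConvex_logBall (hκ : κ ∈ Icc 1 Real.pi) (hk : KappaEquation κ) (hx : x ≠ 0)
    (hM : M ≤ κ) : StarConvex ℝ x (logBall x M) := by
  intro z hz a b ha hb hab
  obtain rfl : a = 1 - b := by linarith
  have hc : halfPlaneCoord x z = 1 + halfPlaneCoord x (z - x) := by
    simpa using halfPlaneCoord_add_smul hx (z - x) zero_le_one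
  have hlog : ‖Complex.log (1 + halfPlaneCoord x (z - x))‖ < M := hc ▸ hz.2
  have hslit : 1 + halfPlaneCoord x (z - x) ∈ Complex.slitPlane :=
    mem_slitPlane_of_norm_log_lt_pi (hc ▸ halfPlaneCoord_ne_zero hx hz.1)
      ((hlog.trans_le hM).trans (lt_pi_of_kappaEquation hκ hk))
  have hb1 : b ∈ Icc 0 1 := ⟨hb, by linarith⟩
  have hw : halfPlaneCoord x ((1 - b) • x + b • z) = 1 + b * halfPlaneCoord x (z - x) := by
    rw [← halfPlaneCoord_add_smul hx _ hb]
    congr 1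
    module
  refine ⟨fun h0 => Complex.slitPlane_ne_zero (one_add_mul_mem_slitPlane hslit hb1) ?_, ?_⟩
  · rw [← hw, h0, halfPlaneCoord_zero]
  · rw [logCoord, hw]
    exact (norm_log_one_add_mul_le hκ hk (halfPlaneCoord_im_nonneg x _) hslit
      (hlog.trans_le hM) hb1).trans_lt hlog

theorem add_smul_sub_mem_logBall (hκ : κ ∈ Icc 1 Real.pi) (hk : KappaEquation κ) (hx : x ≠ 0)
    (hM0 : 0 < M) (hM : M ≤ κ) (hz : z ∈ closure (logBall x M)) {t : ℝ} (ht : t ∈ Ico 0 1) :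
    x + t • (z - x) ∈ logBall x M := by
  rcases eq_or_ne z x with rfl | hzx
  · rw [sub_self, smul_zero, add_zero]
    exact self_mem_logBall hx hM0
  have hray : ∀ s : ℝ, s ∈ Icc 0 1 → x + s • (z - x) ≠ 0 ∧ ‖logCoord x (x + s • (z - x))‖ ≤ M :=
    fun s hs => closure_logBall_subset hx <| map_mem_closure (f := fun w => x + s • (w - x))
      (by fun_prop) hz fun w hw =>
        (starConvex_logBall hκ hk hx hM).add_smul_sub_mem hw hs.1 hs.2
  refine ⟨(hray t (Ico_subset_Icc_self ht)).1, ?_⟩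
  rw [logCoord, halfPlaneCoord_add_smul hx _ ht.1]
  refine norm_log_one_add_mul_lt hκ hk (halfPlaneCoord_ne_zero hx (sub_ne_zero.2 hzx))
    (halfPlaneCoord_im_nonneg x _) hM0 hM (fun s hs => ?_) ht
  rw [← halfPlaneCoord_add_smul hx _ hs.1]
  exact ⟨halfPlaneCoord_ne_zero hx (hray s hs).1, (hray s hs).2⟩

theorem isStrictlyStarlike_logBall (hκ : κ ∈ Icc 1 Real.pi) (hk : KappaEquation κ) (hx : x ≠ 0)
    (hM0 : 0 < M) (hM : M ≤ κ) : IsStrictlyStarlike x (logBall x M) :=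
  isStrictlyStarlike_of_add_smul_sub_mem (isOpen_logBall hx M) (isBounded_logBall hx M)
    (self_mem_logBall hx hM0) fun _ hz _ ht => add_smul_sub_mem_logBall hκ hk hx hM0 hM hz ht

theorem inner_logCoord_nonneg_of_starConvex (hx : x ≠ 0)
    (hstar : StarConvex ℝ x (logBall x ‖logCoord x z‖))
    (hslit : halfPlaneCoord x z ∈ Complex.slitPlane) :
    0 ≤ inner ℝ (logCoord x z) (1 - Complex.exp (-logCoord x z)) := by
  have hz : halfPlaneCoord x z = 1 + (1 : ℝ) * halfPlaneCoord x (z - x) := by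
    simpa using halfPlaneCoord_add_smul hx (z - x) zero_le_one
  have hmin : IsLocalMinOn (fun t : ℝ => ‖Complex.log (1 + t * halfPlaneCoord x (z - x))‖ ^ 2)
      (Ici 1) 1 := by
    have hcont : Continuous fun t : ℝ => 1 + t * halfPlaneCoord x (z - x) := by fun_prop
    filter_upwards [mem_nhdsWithin_of_mem_nhds (hcont.continuousAt.eventually_mem
      (Complex.isOpen_slitPlane.mem_nhds (hz ▸ hslit))), self_mem_nhdsWithin] with t hts ht1
    have ht0 : 0 < t := zero_lt_one.trans_le ht1
    rw [← halfPlaneCoord_add_smul hx _ ht0.le] at hts ⊢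
    rw [← hz]
    refine pow_le_pow_left₀ (norm_nonneg _) (not_lt.1 fun hlt => ?_) 2
    have hmem : x + t • (z - x) ∈ logBall x ‖logCoord x z‖ :=
      ⟨fun h0 => Complex.slitPlane_ne_zero hts (by rw [h0, halfPlaneCoord_zero]), hlt⟩
    have hzmem := hstar.add_smul_sub_mem hmem (inv_nonneg.2 ht0.le) (inv_le_one_of_one_le₀ ht1)
    rw [add_sub_cancel_left, smul_smul, inv_mul_cancel₀ ht0.ne', one_smul, add_sub_cancel]
      at hzmem
    exact lt_irrefl _ hzmem.2
  have hd := hasDerivAt_norm_log_sq_one_add_mul (hz ▸ hslit)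
  have hnonneg := sub_mul_nonneg_of_isLocalMinOn (b := 2) hmin hd
    ((convex_Ici 1).segment_subset self_mem_Ici (by norm_num))
  have hinner := mul_inner_log_div (Complex.slitPlane_ne_zero (hz ▸ hslit))
  rw [← hz] at hnonneg hinner
  rw [logCoord, ← hinner]
  linarith

theorem not_starConvex_logBall_of_pi_lt (hE : 1 < Module.rank ℝ E) (hx : x ≠ 0)
    (hM : Real.pi < M) : ¬StarConvex ℝ x (logBall x M) := by
  intro hstar
  obtain ⟨e, he, hn, -⟩ := exists_planeEmbedding_halfPlaneCoord_eq hE hx x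
  have hmem : -x ∈ logBall x M := by
    have hexp := planeEmbedding_exp_mem_logBall (M := M) (ζ := Real.pi * Complex.I) hx he hn
      (by simpa using Real.pi_pos.le) (by simp) (by simpa [abs_of_pos Real.pi_pos] using hM)
    simpa [Complex.exp_pi_mul_I, planeEmbedding_apply] using hexp
  have hzero := hstar hmem one_half_pos.le one_half_pos.le (add_halves 1)
  rw [smul_neg, add_neg_cancel] at hzero
  exact hzero.1 rfl

theorem not_starConvex_logBall (hE : 1 < Module.rank ℝ E) (hκ : κ ∈ Icc 1 Real.pi)
    (hk : KappaEquation κ) (hx : x ≠ 0) (hM : κ < M) : ¬StarConvex ℝ x (logBall x M) := by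
  rcases lt_or_ge Real.pi M with hπ | hπ
  · exact not_starConvex_logBall_of_pi_lt hE hx hπ
  intro hstar
  have hM1 : 1 ≤ M := hκ.1.trans hM.le
  obtain ⟨e, he, hn, -⟩ := exists_planeEmbedding_halfPlaneCoord_eq hE hx x
  set ζ : ℂ := ⟨-1, √(M ^ 2 - 1)⟩ with hζdef
  have him0 : 0 ≤ ζ.im := Real.sqrt_nonneg _
  have himπ : ζ.im < Real.pi := (sqrt_sq_sub_one_lt (by linarith)).trans_le hπ
  have hζ : ‖ζ‖ = M := norm_mk_neg_one_sqrt_sq_sub_one hM1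
  have hlog : logCoord x (planeEmbedding x e (Complex.exp ζ)) = ζ :=
    logCoord_planeEmbedding_exp hx he hn him0 himπ.le
  have hcoord : halfPlaneCoord x (planeEmbedding x e (Complex.exp ζ)) ∈ Complex.slitPlane := by
    refine Complex.mem_slitPlane_iff_arg.2
      ⟨?_, halfPlaneCoord_ne_zero hx (planeEmbedding_exp_ne_zero hx he hn ζ)⟩
    rw [← Complex.log_im, ← logCoord, hlog]
    exact himπ.ne
  have hnonneg := inner_logCoord_nonneg_of_starConvex hx (by rwa [hlog, hζ]) hcoord
  rw [hlog, hζdef] at hnonneg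
  exact hnonneg.not_gt (inner_one_sub_exp_neg_neg hκ.1 hk hM hπ)

end Starlikeness

theorem one_lt_rank_euclideanSpace {n : ℕ} (hn : 2 ≤ n) :
    1 < Module.rank ℝ (EuclideanSpace ℝ (Fin n)) := by
  rw [rank_eq_card_basis (EuclideanSpace.basisFun (Fin n) ℝ).toBasis, Fintype.card_fin]
  exact_mod_cast hn

theorem theorem1p1_general :
    ∃ κ : ℝ, κ ∈ Icc 1 Real.pi ∧ KappaEquation κ ∧
      (∀ p ∈ Icc 1 Real.pi, KappaEquation p → p = κ) ∧
      |κ - 2.83297| ≤ 0.000005 ∧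
      ∀ (E : Type*) [NormedAddCommGroup E] [InnerProductSpace ℝ E], 1 < Module.rank ℝ E →
        ∀ x : E, x ≠ 0 → ∀ M : ℝ,
          (M ≤ 1 → IsStrictlyConvex (quasihyperbolicBall ({0}ᶜ : Set E) x M)) ∧
          (1 < M → ¬Convex ℝ (quasihyperbolicBall ({0}ᶜ : Set E) x M)) ∧
          (0 < M → M ≤ κ → IsStrictlyStarlike x (quasihyperbolicBall ({0}ᶜ : Set E) x M)) ∧
          (κ < M → ¬StarConvex ℝ x (quasihyperbolicBall ({0}ᶜ : Set E) x M)) := by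
  obtain ⟨κ, hκ, hk, hnum⟩ := exists_kappaEquation
  refine ⟨κ, hκ, hk, fun p hp hpk => kappaEquation_unique hκ hp hk hpk, hnum,
    fun E _ _ hE x hx M => ?_⟩
  rw [quasihyperbolicBall_compl_zero hE hx]
  exact ⟨isStrictlyConvex_logBall hx, not_convex_logBall hE hx,
    isStrictlyStarlike_logBall hκ hk hx, not_starConvex_logBall hE hκ hk hx⟩

end Development

theorem theorem1p1 :
    ∃ κ : ℝ, κ ∈ Set.Icc 1 Real.pi ∧ KappaEquation κ ∧
      (∀ p ∈ Set.Icc 1 Real.pi, KappaEquation p → p = κ) ∧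
      |κ - 2.83297| ≤ 0.000005 ∧
      ∀ n : ℕ, 2 ≤ n → ∀ x : EuclideanSpace ℝ (Fin n), x ≠ 0 → ∀ M : ℝ,
        (0 < M → M ≤ 1 →
          IsStrictlyConvex (quasihyperbolicBall ({0}ᶜ : Set (EuclideanSpace ℝ (Fin n))) x M)) ∧
        (1 < M →
          ¬ Convex ℝ (quasihyperbolicBall ({0}ᶜ : Set (EuclideanSpace ℝ (Fin n))) x M)) ∧
        (0 < M → M ≤ κ →
          IsStrictlyStarlike x
            (quasihyperbolicBall ({0}ᶜ : Set (EuclideanSpace ℝ (Fin n))) x M)) ∧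
        (κ < M →
          ¬ StarConvex ℝ x
            (quasihyperbolicBall ({0}ᶜ : Set (EuclideanSpace ℝ (Fin n))) x M)) := by
  obtain ⟨κ, hκ, hk, huniq, hnum, h⟩ := theorem1p1_general
  exact ⟨κ, hκ, hk, huniq, hnum, fun n hn x hx M =>
    (h _ (one_lt_rank_euclideanSpace hn) x hx M).imp_left fun hconv _ => hconv⟩
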